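/- Let $d \ge 2$ be an integer, let $\Bbbk$ be a field containing a primitive $d$-th root of unity $\zeta$, and let $S_1 = \Bbbk[[x_1,\dots,x_a]]$, $S_2 = \Bbbk[[y_1,\dots,y_b]]$, $S = \Bbbk[[x_1,\dots,x_a,y_1,\dots,y_b]]$. Let $f \in S_1$ and $g \in S_2$ be non-zero non-units. For an element $h$ of a commutative ring $Q$, a ($d$-fold) matrix factorization of $h$ over $Q$ is a $\mathbb{Z}/d$-graded finitely generated projective $Q$-module $X = \bigoplus_{k \in \mathbb{Z}/d} X_k$ with a $Q$-linear map $\varphi : X \to X$ of degree $-1$ such that $\varphi^d = h \cdot 1_X$. Isomorphisms are the $Q$-linear isomorphisms of degree $0$ commuting with the maps $\varphi$, and direct sums are taken degreewise. $X$ is indecomposable if it is non-zero and not isomorphic to a direct sum of two non-zero matrix factorizations of $h$; it has rank $n$ if every $X_k$ is free of rank $n$; if $Q$ is local with maximal ideal $\mathfrak n$, it is reduced if $\varphi(X) \subseteq \mathfrak n X$. Let $(X,\varphi)$ be an indecomposable reduced matrix factorization of $f$ over $S_1$, of rank $n$, and let $(Y,\psi)$ be an indecomposable reduced matrix factorization of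 $g$ over $S_2$, of rank $m$. Extend scalars of both to $S$ and let $X \otimes Y$ be the matrix factorization of $f+g$ over $S$ with $$(X\otimes Y)_k = \bigoplus_{i+j = k \text{ in } \mathbb{Z}/d} X_i \otimes_S Y_j, \qquad \Phi(x \otimes y) = \varphi(x)\otimes y + \zeta^{|x|}\, x \otimes \psi(y)$$ for homogeneous $x$ of degree $|x|$ and homogeneous $y$. Then $X \otimes Y$ is a direct sum of finitely many indecomposable matrix factorizations of $f+g$ over $S$, and every such decomposition has at most $d \cdot \gcd(n,m)$ summands, counted with multiplicity. -/

import Mathlib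

universe u

open scoped TensorProduct

/-- A `d`-fold matrix factorization of `f` over `Q`: finitely generated projective `Q`-modules
`X_k`, indexed by `k ∈ ℤ/d`, together with a degree `-1` map, given by its components
`φ k : X_{k+1} → X_k` (in the customary notation, where a map is indexed by the degree of its
source, this component is `φ_{k+1}`).
The equation `pow_eq` says that the total map `φ` on `⨁ X_k = ∏ X_k` satisfies `φ ^ d = f • 1`;
equivalently, every composition of `d` consecutive components, starting in any degree,
is multiplication by `f`. -/
structure MatFac (Q : Type u) [CommRing Q] (d : ℕ) [NeZero d] (f : Q) where
  obj : ZMod d → Type u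
  [addCommGroup : ∀ k, AddCommGroup (obj k)]
  [module : ∀ k, Module Q (obj k)]
  [finite : ∀ k, Module.Finite Q (obj k)]
  [projective : ∀ k, Module.Projective Q (obj k)]
  φ : ∀ k : ZMod d, obj (k + 1) →ₗ[Q] obj k
  pow_eq : (LinearMap.pi (fun k => (φ k).comp (LinearMap.proj (k + 1))) :
      Module.End Q (∀ k, obj k)) ^ d = f • 1

namespace MatFac

attribute [instance] addCommGroup module finite projective

section Basic

variable {Q : Type u} [CommRing Q] {d : ℕ} [NeZero d] {f : Q}

/-- The total degree `-1` map on `∏ X_k`. -/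
def total (X : MatFac Q d f) : Module.End Q (∀ k, X.obj k) :=
  LinearMap.pi fun k => (X.φ k).comp (LinearMap.proj (k + 1))

theorem total_pow (X : MatFac Q d f) : X.total ^ d = f • 1 := X.pow_eq

/-- An isomorphism of matrix factorizations: a degree zero isomorphism of graded modules
which commutes with the structure maps. -/
structure Iso (X X' : MatFac Q d f) where
  e : ∀ k, X.obj k ≃ₗ[Q] X'.obj k
  comm : ∀ (k : ZMod d) (x : X.obj (k + 1)), e k (X.φ k x) = X'.φ k (e (k + 1) x)

/-- `X` is a zero object. -/
def IsZero (X : MatFac Q d f) : Prop := ∀ k, Subsingleton (X.obj k)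

/-- `X` has rank `n`: every `X_k` is a free module of rank `n`. -/
def HasRank (X : MatFac Q d f) (n : ℕ) : Prop :=
  ∀ k, Module.Free Q (X.obj k) ∧ Module.finrank Q (X.obj k) = n

/-- Over a local ring, `X` is reduced if the image of each structure map lies in
the maximal ideal times the target. -/
def IsReduced [IsLocalRing Q] (X : MatFac Q d f) : Prop :=
  ∀ k, LinearMap.range (X.φ k) ≤
    IsLocalRing.maximalIdeal Q • (⊤ : Submodule Q (X.obj k))

theorem pow_intertwine {M N : Type*} [AddCommGroup M] [Module Q M] [AddCommGroup N] [Module Q N]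
    (e : M →ₗ[Q] N) (S : Module.End Q M) (T : Module.End Q N)
    (h : ∀ x, e (S x) = T (e x)) (n : ℕ) (x : M) : e ((S ^ n) x) = (T ^ n) (e x) := by
  induction n generalizing x with
  | zero => simp
  | succ n ih => rw [pow_succ, pow_succ, Module.End.mul_apply, Module.End.mul_apply, ih, h]

/-- The direct sum of two matrix factorizations. -/
def prod (X X' : MatFac Q d f) : MatFac Q d f where
  obj k := X.obj k × X'.obj k
  φ k := (X.φ k).prodMap (X'.φ k)
  pow_eq := by
    refine LinearMap.ext fun x => funext fun k => Prod.ext ?_ ?_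
    · have h := pow_intertwine
        (LinearMap.pi fun k => (LinearMap.fst Q (X.obj k) (X'.obj k)).comp (LinearMap.proj k))
        (LinearMap.pi fun k => ((X.φ k).prodMap (X'.φ k)).comp (LinearMap.proj (k + 1)))
        X.total (fun _ => rfl) d x
      rw [total_pow] at h
      exact congrFun h k
    · have h := pow_intertwine
        (LinearMap.pi fun k => (LinearMap.snd Q (X.obj k) (X'.obj k)).comp (LinearMap.proj k))
        (LinearMap.pi fun k => ((X.φ k).prodMap (X'.φ k)).comp (LinearMap.proj (k + 1)))
        X'.total (fun _ => rfl) d x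
      rw [total_pow] at h
      exact congrFun h k

theorem projective_pi {ι : Type*} [Finite ι] (M : ι → Type*) [∀ i, AddCommGroup (M i)]
    [∀ i, Module Q (M i)] [∀ i, Module.Projective Q (M i)] :
    Module.Projective Q (∀ i, M i) := by
  classical
  cases nonempty_fintype ι
  exact Module.Projective.of_equiv (DirectSum.linearEquivFunOnFintype Q ι M)

/-- The direct sum of a finite family of matrix factorizations. -/
def directSum {ι : Type} [Finite ι] (Z : ι → MatFac Q d f) : MatFac Q d f where
  obj k := ∀ i, (Z i).obj k
  projective _ := projective_pi _
  φ k := LinearMap.pi fun i => ((Z i).φ k).comp (LinearMap.proj i)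
  pow_eq := by
    refine LinearMap.ext fun x => funext fun k => funext fun i => ?_
    have h := pow_intertwine
      (LinearMap.pi fun k => (LinearMap.proj (R := Q) (φ := fun i => (Z i).obj k) i).comp
        (LinearMap.proj k))
      (LinearMap.pi fun k => (LinearMap.pi fun i => ((Z i).φ k).comp (LinearMap.proj i)).comp
        (LinearMap.proj (k + 1)))
      (Z i).total (fun _ => rfl) d x
    rw [total_pow] at h
    exact congrFun h k

/-- `X` is indecomposable: it is non-zero, and it is not isomorphic to a direct sum of two
non-zero matrix factorizations. -/
def Indecomposable (X : MatFac Q d f) : Prop :=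
  ¬ X.IsZero ∧ ∀ A B : MatFac Q d f, Nonempty (Iso X (A.prod B)) → A.IsZero ∨ B.IsZero

/-- `X` is the direct sum of `N` indecomposable matrix factorizations. -/
def DecomposesInto (X : MatFac Q d f) (N : ℕ) : Prop :=
  ∃ Z : Fin N → MatFac Q d f, (∀ i, (Z i).Indecomposable) ∧ Nonempty (Iso X (directSum Z))

end Basic

section BaseChange

variable {Q Q' : Type u} [CommRing Q] [CommRing Q'] {d : ℕ} [NeZero d] {f : Q}

/-- Extension of scalars of a matrix factorization to a `Q`-algebra `Q'`. -/
noncomputable def extendScalars [Algebra Q Q'] (X : MatFac Q d f) :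
    MatFac Q' d (algebraMap Q Q' f) where
  obj k := Q' ⊗[Q] X.obj k
  φ k := (X.φ k).baseChange Q'
  pow_eq := by
    refine LinearMap.ext fun x => ?_
    obtain ⟨t, rfl⟩ := (TensorProduct.piRight Q Q' Q' X.obj).surjective x
    refine (pow_intertwine (TensorProduct.piRight Q Q' Q' X.obj).toLinearMap
      (X.total.baseChange Q') _ ?_ d t).symm.trans ?_
    · intro t
      induction t using TensorProduct.induction_on with
      | zero => simp
      | tmul q x => rfl
      | add s t hs ht => rw [map_add, map_add, map_add, map_add, hs, ht]
    · rw [← LinearMap.baseChange_pow, total_pow]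
      induction t using TensorProduct.induction_on with
      | zero => simp
      | tmul q x =>
        ext k
        simp [TensorProduct.smul_tmul']
      | add s t hs ht => rw [map_add, map_add, map_add, map_add, hs, ht]

/-- Extension of scalars of a matrix factorization along a ring homomorphism. -/
noncomputable def baseChange (ι : Q →+* Q') (X : MatFac Q d f) : MatFac Q' d (ι f) :=
  letI := ι.toAlgebra
  X.extendScalars

end BaseChange

section QBinomial

/-- Gaussian binomial coefficients. -/
def qBinom {Q : Type*} [CommRing Q] (q : Q) : ℕ → ℕ → Q
  | _, 0 => 1
  | 0, _ + 1 => 0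
  | n + 1, k + 1 => qBinom q n k + q ^ (k + 1) * qBinom q n (k + 1)

variable {Q : Type*} [CommRing Q] (q : Q)

theorem qBinom_zero_right (n : ℕ) : qBinom q n 0 = 1 := by cases n <;> rfl

theorem qBinom_succ (n k : ℕ) :
    qBinom q (n + 1) (k + 1) = qBinom q n k + q ^ (k + 1) * qBinom q n (k + 1) := rfl

theorem qBinom_gt (n k : ℕ) (h : n < k) : qBinom q n k = 0 := by
  induction n generalizing k with
  | zero =>
    cases k with
    | zero => omega
    | succ k => rfl
  | succ n ih =>
    cases k with
    | zero => omega
    | succ k => rw [qBinom_succ, ih _ (by omega), ih _ (by omega)]; ring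

theorem qBinom_self (n : ℕ) : qBinom q n n = 1 := by
  induction n with
  | zero => rfl
  | succ n ih => rw [qBinom_succ, ih, qBinom_gt q n _ (by omega)]; ring

theorem qBinom_absorb (n : ℕ) : ∀ k,
    qBinom q (n + 1) (k + 1) * (q ^ (k + 1) - 1) = (q ^ (n + 1) - 1) * qBinom q n k := by
  induction n with
  | zero =>
    intro k
    cases k with
    | zero => simp [qBinom]
    | succ k => simp [qBinom]
  | succ n ih =>
    intro k
    have hR : (q ^ (n + 1) - q ^ k) * qBinom q (n + 1) k
        = q ^ k * (q ^ (n + 1) - 1) * qBinom q n k := by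
      cases k with
      | zero => simp [qBinom_zero_right]
      | succ k =>
        have h1 := ih k
        rw [qBinom_succ] at h1 ⊢
        linear_combination -h1
    have h2 := ih k
    rw [qBinom_succ q (n + 1) k]
    linear_combination q ^ (k + 1) * h2 - q * hR

theorem add_pow_qBinom {R : Type*} [Ring R] [Algebra Q R] (A B : R) (h : A * B = q • (B * A))
    (n : ℕ) : (A + B) ^ n =
      ∑ k ∈ Finset.range (n + 1), qBinom q n k • (B ^ k * A ^ (n - k)) := by
  have hA : ∀ k, A * B ^ k = q ^ k • (B ^ k * A) := by
    intro k
    induction k with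
    | zero => simp
    | succ k ih =>
      rw [pow_succ, ← mul_assoc, ih, smul_mul_assoc, mul_assoc, h, mul_smul_comm, smul_smul,
        ← mul_assoc, ← pow_succ]
  induction n with
  | zero => simp [qBinom]
  | succ n ih =>
    rw [pow_succ', ih, add_mul, Finset.mul_sum, Finset.mul_sum]
    have e1 : ∀ k ∈ Finset.range (n + 1), A * qBinom q n k • (B ^ k * A ^ (n - k))
        = (q ^ k * qBinom q n k) • (B ^ k * A ^ (n + 1 - k)) := by
      intro k hk
      have hk' : n + 1 - k = (n - k) + 1 := by
        have := Finset.mem_range.mp hk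
        omega
      rw [mul_smul_comm, ← mul_assoc, hA, smul_mul_assoc, smul_smul, mul_assoc, hk', pow_succ',
        mul_comm (q ^ k)]
    have e2 : ∀ k ∈ Finset.range (n + 1), B * qBinom q n k • (B ^ k * A ^ (n - k))
        = qBinom q n k • (B ^ (k + 1) * A ^ (n + 1 - (k + 1))) := by
      intro k _
      rw [mul_smul_comm, ← mul_assoc, ← pow_succ', Nat.add_sub_add_right]
    rw [Finset.sum_congr rfl e1, Finset.sum_congr rfl e2]
    rw [Finset.sum_range_succ' _ (n + 1)]
    have e3 : ∑ k ∈ Finset.range (n + 1), (q ^ k * qBinom q n k) • (B ^ k * A ^ (n + 1 - k))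
        = ∑ k ∈ Finset.range (n + 1), (q ^ (k + 1) * qBinom q n (k + 1)) •
            (B ^ (k + 1) * A ^ (n + 1 - (k + 1))) + B ^ 0 * A ^ (n + 1 - 0) := by
      rw [Finset.sum_range_succ', Finset.sum_range_succ _ n, qBinom_gt q n (n + 1) (by omega),
        qBinom_zero_right]
      simp
    rw [e3, qBinom_zero_right, one_smul, add_right_comm, ← Finset.sum_add_distrib]
    congr 1
    refine Finset.sum_congr rfl fun k _ => ?_
    rw [← add_smul, qBinom_succ, add_comm]

theorem add_pow_of_root {K : Type*} [Field K] [Algebra K Q] {R : Type*} [Ring R] [Algebra Q R]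
    {ζ : K} {d : ℕ} (hd : d ≠ 0) (hζ : IsPrimitiveRoot ζ d) (A B : R)
    (h : A * B = algebraMap K Q ζ • (B * A)) : (A + B) ^ d = A ^ d + B ^ d := by
  obtain ⟨n, rfl⟩ := Nat.exists_eq_succ_of_ne_zero hd
  rw [add_pow_qBinom _ A B h, Finset.sum_range_succ, Finset.sum_range_succ', qBinom_self,
    qBinom_zero_right, Finset.sum_eq_zero]
  · simp
  · intro k hk
    have hk' := Finset.mem_range.mp hk
    have h1 := qBinom_absorb (algebraMap K Q ζ) n k
    have hu : IsUnit (algebraMap K Q ζ ^ (k + 1) - 1) := by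
      have : ζ ^ (k + 1) - 1 ≠ 0 :=
        sub_ne_zero.mpr (hζ.pow_ne_one_of_pos_of_lt (by omega) (by omega))
      simpa using (IsUnit.mk0 _ this).map (algebraMap K Q)
    have h0 : (algebraMap K Q ζ) ^ (n + 1) = 1 := by
      rw [← map_pow]
      have := hζ.pow_eq_one
      simp only [Nat.succ_eq_add_one] at this
      rw [this, map_one]
    rw [h0, sub_self, zero_mul] at h1
    rw [hu.mul_left_eq_zero.mp h1, zero_smul]

end QBinomial

section Tensor

variable {K Q : Type u} [Field K] [CommRing Q] [Algebra K Q] {d : ℕ} [NeZero d] {f g : Q}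

/-- The degree `k` part `⨁_{i + j = k} X_i ⊗ Y_j` of the tensor product. -/
abbrev TensorObj (X : MatFac Q d f) (Y : MatFac Q d g) (k : ZMod d) : Type u :=
  ∀ p : {p : ZMod d × ZMod d // p.1 + p.2 = k}, X.obj p.1.1 ⊗[Q] Y.obj p.1.2

/-- The structure map `(X ⊗ Y)_{k+1} → (X ⊗ Y)_k`, that is
`x ⊗ y ↦ φ x ⊗ y + ζ ^ |x| • x ⊗ ψ y`: the component of the image in `X_i ⊗ Y_j`, `i + j = k`,
comes from the components in `X_{i+1} ⊗ Y_j` and in `X_i ⊗ Y_{j+1}`. -/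
noncomputable def tensorMap (ζ : K) (X : MatFac Q d f) (Y : MatFac Q d g) (k : ZMod d) :
    TensorObj X Y (k + 1) →ₗ[Q] TensorObj X Y k :=
  LinearMap.pi fun p =>
    (TensorProduct.map (X.φ p.1.1) LinearMap.id).comp
        (LinearMap.proj
          (⟨(p.1.1 + 1, p.1.2), by linear_combination p.2⟩ :
            {q : ZMod d × ZMod d // q.1 + q.2 = k + 1})) +
      (algebraMap K Q ζ ^ p.1.1.val) •
        (TensorProduct.map LinearMap.id (Y.φ p.1.2)).comp
          (LinearMap.proj
            (⟨(p.1.1, p.1.2 + 1), by linear_combination p.2⟩ :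
              {q : ZMod d × ZMod d // q.1 + q.2 = k + 1}))

/-- The canonical map `(∏ X_i) ⊗ (∏ Y_j) → ∏_k ∏_{i+j=k} X_i ⊗ Y_j`. -/
noncomputable def tensorComparison (X : MatFac Q d f) (Y : MatFac Q d g) :
    ((∀ i, X.obj i) ⊗[Q] (∀ j, Y.obj j)) →ₗ[Q] (∀ k, TensorObj X Y k) :=
  LinearMap.pi fun _ => LinearMap.pi fun p =>
    TensorProduct.map (LinearMap.proj p.1.1) (LinearMap.proj p.1.2)

theorem tensorComparison_surjective (X : MatFac Q d f) (Y : MatFac Q d g) :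
    Function.Surjective (tensorComparison X Y) := by
  classical
  rw [← LinearMap.range_eq_top, eq_top_iff]
  rintro t -
  have ht : t = ∑ k, Pi.single k (∑ p, Pi.single p (t k p)) := by
    simp only [Finset.univ_sum_single]
  rw [ht]
  refine Submodule.sum_mem _ fun k _ => ?_
  have hs : (Pi.single k (∑ p, Pi.single p (t k p)) : ∀ k, TensorObj X Y k) =
      ∑ p, Pi.single k (Pi.single p (t k p)) :=
    map_sum (LinearMap.single Q (fun k => TensorObj X Y k) k) _ _
  rw [hs]
  refine Submodule.sum_mem _ fun p _ => ?_
  generalize t k p = w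
  obtain ⟨⟨i, j⟩, rfl⟩ := p
  induction w using TensorProduct.induction_on with
  | zero => simp
  | tmul x y =>
    refine ⟨(Pi.single i x) ⊗ₜ (Pi.single j y), ?_⟩
    refine funext fun k' => funext fun p' => ?_
    obtain ⟨⟨i', j'⟩, rfl⟩ := p'
    change (Pi.single i x : ∀ i, X.obj i) i' ⊗ₜ[Q] (Pi.single j y : ∀ j, Y.obj j) j' = _
    by_cases hi : i' = i
    · subst hi
      by_cases hj : j' = j
      · subst hj
        simp
      · have hk : i' + j' ≠ i' + j := fun h => hj (add_left_cancel h)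
        rw [Pi.single_eq_of_ne hj, Pi.single_eq_of_ne hk]
        simp
    · rw [Pi.single_eq_of_ne hi, TensorProduct.zero_tmul]
      by_cases hk : i' + j' = i + j
      · have key : ∀ (k' : ZMod d) (hk : k' = i + j) (h' : i' + j' = k'),
            (0 : X.obj i' ⊗[Q] Y.obj j') =
              (Pi.single (i + j) (Pi.single ⟨(i, j), rfl⟩ (x ⊗ₜ[Q] y)) :
                ∀ k, TensorObj X Y k) k' ⟨(i', j'), h'⟩ := by
          rintro k' rfl h'
          rw [Pi.single_eq_same, Pi.single_eq_of_ne]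
          intro h
          exact hi (congrArg (fun q => q.1.1) h)
        exact key _ hk rfl
      · rw [Pi.single_eq_of_ne hk]
        rfl
  | add s t hs ht =>
    rw [Pi.single_add, Pi.single_add]
    exact add_mem hs ht

/-- The operator `x ↦ ζ ^ |x| • x`. -/
noncomputable def twist (ζ : K) (X : MatFac Q d f) : Module.End Q (∀ i, X.obj i) :=
  LinearMap.pi fun i => (algebraMap K Q ζ ^ i.val) • LinearMap.proj i

theorem pow_val_add_one {ζ : K} (hζ : ζ ^ d = 1) (i : ZMod d) :
    algebraMap K Q ζ ^ (i + 1).val = algebraMap K Q ζ * algebraMap K Q ζ ^ i.val := by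
  rw [← pow_succ', ← map_pow, ← map_pow, ZMod.val_add, ← pow_mod_orderOf]
  conv_rhs => rw [← pow_mod_orderOf]
  rw [Nat.mod_mod_of_dvd _ (orderOf_dvd_of_pow_eq_one hζ), Nat.add_mod, ZMod.val_one_eq_one_mod,
    Nat.mod_mod_of_dvd _ (orderOf_dvd_of_pow_eq_one hζ), ← Nat.add_mod]

theorem total_mul_twist {ζ : K} (hζ : ζ ^ d = 1) (X : MatFac Q d f) :
    X.total * twist ζ X = algebraMap K Q ζ • (twist ζ X * X.total) := by
  refine LinearMap.ext fun x => funext fun i => ?_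
  change X.φ i ((algebraMap K Q ζ ^ (i + 1).val) • x (i + 1)) =
    algebraMap K Q ζ • (algebraMap K Q ζ ^ i.val) • X.φ i (x (i + 1))
  rw [map_smul, pow_val_add_one hζ, mul_smul]

theorem twist_pow {ζ : K} (hζ : ζ ^ d = 1) (X : MatFac Q d f) : twist ζ X ^ d = 1 := by
  have h : ∀ (n : ℕ) (x : ∀ i, X.obj i) (i : ZMod d),
      ((twist ζ X ^ n) x) i = (algebraMap K Q ζ ^ i.val) ^ n • x i := by
    intro n
    induction n with
    | zero => intro x i; simp
    | succ n ih =>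
      intro x i
      rw [pow_succ, Module.End.mul_apply, ih, pow_succ, mul_smul]
      rfl
  refine LinearMap.ext fun x => funext fun i => ?_
  rw [h, ← pow_mul, mul_comm, pow_mul, ← map_pow, hζ, map_one, one_pow, one_smul]
  rfl

/-- The tensor product `X ⊗ Y`, taken with respect to the primitive root of unity `ζ`; it is a
matrix factorization of `f + g`. -/
noncomputable def tensor (ζ : K) (hζ : IsPrimitiveRoot ζ d)
    (X : MatFac Q d f) (Y : MatFac Q d g) : MatFac Q d (f + g) where
  obj := TensorObj X Y
  projective _ := projective_pi _
  φ := tensorMap ζ X Y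
  pow_eq := by
    refine LinearMap.ext fun x => ?_
    obtain ⟨t, rfl⟩ := tensorComparison_surjective X Y x
    let A : Module.End Q ((∀ i, X.obj i) ⊗[Q] (∀ j, Y.obj j)) :=
      TensorProduct.map X.total LinearMap.id
    let B : Module.End Q ((∀ i, X.obj i) ⊗[Q] (∀ j, Y.obj j)) :=
      TensorProduct.map (twist ζ X) Y.total
    have hAB : A * B = algebraMap K Q ζ • (B * A) := by
      have h1 : A * B = TensorProduct.map (X.total * twist ζ X) Y.total :=
        (TensorProduct.map_comp _ _ _ _).symm
      have h2 : B * A = TensorProduct.map (twist ζ X * X.total) Y.total :=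
        (TensorProduct.map_comp _ _ _ _).symm
      rw [h1, h2, total_mul_twist hζ.pow_eq_one, TensorProduct.map_smul_left]
    have hA : A ^ d = f • 1 := by
      have : A ^ d = TensorProduct.map (X.total ^ d) (LinearMap.id ^ d) :=
        TensorProduct.map_pow _ _ _
      rw [this, total_pow, TensorProduct.map_smul_left]
      congr 1
      have h1 : (LinearMap.id : Module.End Q (∀ j, Y.obj j)) ^ d = 1 := one_pow d
      rw [h1]
      exact TensorProduct.map_one
    have hB : B ^ d = g • 1 := by
      have : B ^ d = TensorProduct.map (twist ζ X ^ d) (Y.total ^ d) :=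
        TensorProduct.map_pow _ _ _
      rw [this, total_pow, twist_pow hζ.pow_eq_one, TensorProduct.map_smul_right]
      congr 1
      exact TensorProduct.map_one
    refine (pow_intertwine (tensorComparison X Y) (A + B) _ ?_ d t).symm.trans ?_
    · intro t
      induction t using TensorProduct.induction_on with
      | zero => simp
      | tmul x y =>
        refine funext fun k => funext fun p => ?_
        change X.φ p.1.1 (x (p.1.1 + 1)) ⊗ₜ[Q] y p.1.2 +
          (algebraMap K Q ζ ^ p.1.1.val • x p.1.1) ⊗ₜ[Q] Y.φ p.1.2 (y (p.1.2 + 1)) =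
          X.φ p.1.1 (x (p.1.1 + 1)) ⊗ₜ[Q] y p.1.2 +
          algebraMap K Q ζ ^ p.1.1.val • (x p.1.1 ⊗ₜ[Q] Y.φ p.1.2 (y (p.1.2 + 1)))
        rw [TensorProduct.smul_tmul']
      | add s t hs ht => rw [map_add, map_add, map_add, map_add, hs, ht]
    · rw [add_pow_of_root (NeZero.ne d) hζ A B hAB, hA, hB, ← add_smul, LinearMap.smul_apply,
        map_smul]
      rfl

end Tensor

section PowerSeries

variable {K : Type u} [Field K] {a b : ℕ}

/-- The inclusion `K⟦x⟧ → K⟦x, y⟧`. -/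
noncomputable def inclLeft (K : Type u) [Field K] (a b : ℕ) :
    MvPowerSeries (Fin a) K →+* MvPowerSeries (Fin a ⊕ Fin b) K :=
  (MvPowerSeries.rename (Function.Embedding.inl : Fin a ↪ Fin a ⊕ Fin b)).toRingHom

/-- The inclusion `K⟦y⟧ → K⟦x, y⟧`. -/
noncomputable def inclRight (K : Type u) [Field K] (a b : ℕ) :
    MvPowerSeries (Fin b) K →+* MvPowerSeries (Fin a ⊕ Fin b) K :=
  (MvPowerSeries.rename (Function.Embedding.inr : Fin b ↪ Fin a ⊕ Fin b)).toRingHom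

/-- For matrix factorizations `X` of `f ∈ K⟦x⟧` and `Y` of `g ∈ K⟦y⟧`, the matrix factorization
`X ⊗ Y` of `f + g` over `K⟦x, y⟧`. -/
noncomputable def disjointTensor {d : ℕ} [NeZero d] (ζ : K) (hζ : IsPrimitiveRoot ζ d)
    {f : MvPowerSeries (Fin a) K} {g : MvPowerSeries (Fin b) K}
    (X : MatFac (MvPowerSeries (Fin a) K) d f) (Y : MatFac (MvPowerSeries (Fin b) K) d g) :
    MatFac (MvPowerSeries (Fin a ⊕ Fin b) K) d (inclLeft K a b f + inclRight K a b g) :=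
  tensor ζ hζ (X.baseChange (inclLeft K a b)) (Y.baseChange (inclRight K a b))

end PowerSeries

end MatFac

/-!
The bound comes from divisibility of ranks. Setting the variables `y` to zero kills the structure
maps of the reduced matrix factorization `Y`, so it turns `X ⊗ Y` into a direct sum of `d m` shifts
of `X` (`MatFac.exists_restrict_left_equiv`). The power series ring is noetherian and complete, so
idempotents lift along the maximal ideal, and the indecomposable `X` has a local endomorphism
ring (`MatFac.Indecomposable.isUnit_or_isUnit_one_sub`). By the Krull-Schmidt theorem, here in the
form `exists_nsmul_eq_of_local_corners` for idempotents of the endomorphism ring, every direct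
summand `Z` of `X ⊗ Y` restricts to a direct sum of shifts of `X`; hence all `Z_k` have the same
rank, a multiple of `n` (`MatFac.exists_finrank_eq_mul_of_baseChange_equiv`). Setting `x` to zero
shows in the same way that this rank is a multiple of `m`
(`MatFac.exists_restrict_right_equiv`); here the shifts of `Y` carry structure maps multiplied by
powers of `ζ`, which does not change their endomorphisms.

So the degree zero part of an indecomposable summand, being nonzero, has rank at least `lcm n m`,
while that of `X ⊗ Y` has rank `d n m = d gcd(n, m) lcm(n, m)`
(`MatFac.le_mul_gcd_of_decomposesInto`). A decomposition exists by induction on the total rank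
(`MatFac.exists_decomposesInto`).
-/

/-! ### Krull-Schmidt for idempotents with local corner rings -/

section KrullSchmidt

variable {E : Type*} [Ring E]

/-- The exchange step. Let `c` be an idempotent below `G = e + e'`, where `e` and `e'` are
orthogonal idempotents, and suppose that `e` acts invertibly on `c`, that is, `c e c` is invertible
in the corner ring of `c`. Then `e` dominates an idempotent `h` equivalent to `c` such that the
complements `G - h` and `G - c` are equivalent, too. Equivalence of idempotents means `a b` and
`b a`; in an endomorphism ring this is isomorphism of the images. -/
theorem exists_idempotent_equiv_of_invertible_corner {c e e' G u : E} (hc : c * c = c)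
    (he : e * e = e) (hee' : e * e' = 0) (he'e : e' * e = 0) (hG : e + e' = G)
    (hcG : c * G = c) (hGc : G * c = c) (hGG : G * G = G)
    (hu : u * (c * e * c) = c) (hu' : c * e * c * u = c) :
    ∃ h : E, h * h = h ∧ e * h = h ∧ h * e = h ∧ (∃ a b, a * b = h ∧ b * a = c) ∧
      ∃ a b, a * b = G - h ∧ b * a = G - c := by
  -- `v` is the inverse of `c e c` in the corner ring.
  obtain ⟨v, hv⟩ : ∃ v, v = c * u * c := ⟨_, rfl⟩
  have hcv : c * v = v := by rw [hv, ← mul_assoc, ← mul_assoc, hc]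
  have hvc : v * c = v := by rw [hv, mul_assoc, hc]
  have h1 : v * e * c = c := by
    have : v * e * c = c * (u * (c * e * c)) := by rw [hv]; simp only [mul_assoc]
    rw [this, hu, hc]
  have h2 : c * e * v = c := by
    have : c * e * v = (c * e * c * u) * c := by rw [hv]; simp only [mul_assoc]
    rw [this, hu', hc]
  have h3 : v * e * v = v := by
    have : v * e * v = v * (c * e * v) := by
      rw [← mul_assoc, ← mul_assoc, hvc]
    rw [this, h2, hvc]
  have heG : e * G = e := by rw [← hG, mul_add, he, hee', add_zero]
  have hGe : G * e = e := by rw [← hG, add_mul, he, he'e, add_zero]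
  have h3' : ∀ x, v * (e * (v * x)) = v * x := fun x => by
    rw [← mul_assoc, ← mul_assoc, h3]
  have he' : ∀ x, e * (e * x) = e * x := fun x => by rw [← mul_assoc, he]
  have hcv' : ∀ x, c * (v * x) = v * x := fun x => by rw [← mul_assoc, hcv]
  have hvG : v * G = v := by rw [← hvc, mul_assoc, hcG]
  have hGe' : ∀ x, G * (e * x) = e * x := fun x => by rw [← mul_assoc, hGe]
  have h1' : v * (e * c) = c := by rw [← mul_assoc, h1]
  have h2' : c * (e * v) = c := by rw [← mul_assoc, h2]
  have h3'' : v * (e * v) = v := by rw [← mul_assoc, h3]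
  -- The idempotent `e v` has the image of `h = e v e` and the kernel of `c`; so it links the
  -- complement of `h` with the complement of `c`.
  refine ⟨e * v * e, ?_, ?_, ?_, ⟨e * c, v * e, ?_, ?_⟩, (G - e * v * e) * (G - c), G - e * v,
    ?_, ?_⟩
  · simp only [mul_assoc, he', h3']
  · simp only [mul_assoc, he']
  · simp only [mul_assoc, he]
  · simp only [mul_assoc, hcv']
  · simp only [mul_assoc, he', h1']
  · simp only [mul_sub, sub_mul, mul_assoc, he', h3'', hGe', hGc, hcG, hGG, heG, h2']
    abel
  · simp only [mul_sub, sub_mul, mul_assoc, h3', hvG, hGe', hGG, hGc, heG, hvc, h1']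
    abel

/-- The Krull-Schmidt property, in the form of a statement on ranks: let `rk` be an additive
function on idempotents which is invariant under equivalence, and let `c i` be orthogonal
idempotents with local corner rings, all of rank `r`. If the sum of two orthogonal idempotents
`e`, `e'` is equivalent to a sum of some `c i`, then the rank of `e` is a multiple of `r`. -/
theorem exists_nsmul_eq_of_local_corners {A : Type*} [AddCancelCommMonoid A] (rk : E → A)
    (hadd : ∀ e f, e * e = e → f * f = f → e * f = 0 → f * e = 0 → rk (e + f) = rk e + rk f)
    (hinv : ∀ a b, (a * b) * (a * b) = a * b → (b * a) * (b * a) = b * a → rk (a * b) = rk (b * a))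
    {ι : Type*} (r : A) (c : ι → E) (hc : OrthogonalIdempotents c) (hr : ∀ i, rk (c i) = r)
    (hloc : ∀ i x, (∃ u, u * (c i * x * c i) = c i ∧ c i * x * c i * u = c i) ∨
      ∃ u, u * (c i - c i * x * c i) = c i ∧ (c i - c i * x * c i) * u = c i)
    (s : Finset ι) : ∀ e e' a b : E, e * e = e → e' * e' = e' → e * e' = 0 → e' * e = 0 →
      a * b = e + e' → b * a = ∑ i ∈ s, c i → ∃ t : ℕ, rk e = t • r := by
  classical
  have hzero : rk 0 = 0 := by
    have := hadd 0 0 (by simp) (by simp) (by simp) (by simp)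
    simpa using this
  induction s using Finset.induction_on with
  | empty =>
    intro e e' a b he he' hee' he'e hab hba
    refine ⟨0, ?_⟩
    have h0 : a * b = 0 := by
      have h1 : (a * b) * (a * b) = a * b := by
        rw [hab]; simp only [mul_add, add_mul, he, he', hee', he'e, add_zero, zero_add]
      rw [← h1, mul_assoc, ← mul_assoc b, hba]; simp
    have : e = 0 := by
      calc e = e * (e + e') := by rw [mul_add, he, hee', add_zero]
        _ = 0 := by rw [← hab, h0, mul_zero]
    rw [this, hzero, zero_smul]
  | insert i s hi ih =>
    intro e e' a b he he' hee' he'e hab hba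
    rw [Finset.sum_insert hi] at hba
    have hcc : c i * c i = c i := hc.idem i
    have hcs : c i * ∑ j ∈ s, c j = 0 := by
      rw [Finset.mul_sum]
      exact Finset.sum_eq_zero fun j hj => hc.ortho (fun h => hi (h ▸ hj))
    have hsc : (∑ j ∈ s, c j) * c i = 0 := by
      rw [Finset.sum_mul]
      exact Finset.sum_eq_zero fun j hj => hc.ortho (fun h => hi (h ▸ hj))
    have hss : (∑ j ∈ s, c j) * (∑ j ∈ s, c j) = ∑ j ∈ s, c j := hc.isIdempotentElem_sum
    -- Transport `e` and `e'` along the equivalence, so that `e + e'` becomes `G`.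
    obtain ⟨G, hGdef⟩ : ∃ G, G = c i + ∑ j ∈ s, c j := ⟨_, rfl⟩
    rw [← hGdef] at hba
    have heG : e * (a * b) = e := by rw [hab, mul_add, he, hee', add_zero]
    have he'G : e' * (a * b) = e' := by rw [hab, mul_add, he', he'e, zero_add]
    have hGG : G * G = G := by
      rw [hGdef]; simp only [mul_add, add_mul, hcc, hcs, hsc, hss, add_zero, zero_add]
    have hcG : c i * G = c i := by rw [hGdef, mul_add, hcc, hcs, add_zero]
    have hGc : G * c i = c i := by rw [hGdef, add_mul, hcc, hsc, add_zero]
    have key : ∀ p q : E, p * (a * b) = p → (b * p * a) * (b * q * a) = b * (p * q) * a := by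
      intro p q hp
      calc (b * p * a) * (b * q * a) = b * (p * (a * b)) * q * a := by simp only [mul_assoc]
        _ = b * (p * q) * a := by rw [hp]; simp only [mul_assoc]
    have f1 : (b * e * a) * (b * e * a) = b * e * a := by rw [key _ _ heG, he]
    have f2 : (b * e' * a) * (b * e' * a) = b * e' * a := by rw [key _ _ he'G, he']
    have f3 : (b * e * a) * (b * e' * a) = 0 := by rw [key _ _ heG, hee']; simp
    have f4 : (b * e' * a) * (b * e * a) = 0 := by rw [key _ _ he'G, he'e]; simp
    have f5 : b * e * a + b * e' * a = G := by
      rw [← add_mul, ← mul_add, ← hab, ← mul_assoc, mul_assoc, hba, hGG]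
    have f6 : rk (b * e * a) = rk e := by
      have e1 : (b * e) * (e * a) = b * e * a := by
        rw [mul_assoc, ← mul_assoc e, he, ← mul_assoc]
      have e2 : (e * a) * (b * e) = e := by
        rw [mul_assoc, ← mul_assoc a, ← mul_assoc, heG, he]
      have := hinv (b * e) (e * a) (by rw [e1, f1]) (by rw [e2, he])
      rwa [e1, e2] at this
    rw [← f6]
    generalize b * e * a = p at f1 f3 f4 f5 ⊢
    generalize b * e' * a = q at f2 f3 f4 f5
    have hGs : G - c i = ∑ j ∈ s, c j := by rw [hGdef, add_sub_cancel_left]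
    have hq : c i - c i * p * c i = c i * q * c i := by
      rw [sub_eq_iff_eq_add', ← add_mul, ← mul_add, f5, hcG, hcc]
    -- As the corner of `c i` is local, `p` or `q` acts invertibly on `c i`; split off from it an
    -- idempotent equivalent to `c i`.
    rcases hloc i p with ⟨w, hw, hw'⟩ | ⟨w, hw, hw'⟩
    · obtain ⟨h, hh, hph, hhp, ⟨x, y, hxy, hyx⟩, x', y', hxy', hyx'⟩ :=
        exists_idempotent_equiv_of_invertible_corner hcc f1 f3 f4 f5 hcG hGc hGG hw hw'
      have hhq : h * q = 0 := by rw [← hhp, mul_assoc, f3, mul_zero]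
      have hqh : q * h = 0 := by rw [← hph, ← mul_assoc, f4, zero_mul]
      have hpp : (p - h) * (p - h) = p - h := by
        simp only [mul_sub, sub_mul, f1, hph, hhp, hh]; abel
      obtain ⟨t, ht⟩ := ih (p - h) q x' y' hpp f2
        (by rw [sub_mul, f3, hhq, sub_zero]) (by rw [mul_sub, f4, hqh, sub_zero])
        (by rw [hxy', ← f5]; abel) (by rw [hyx', hGs])
      have h4 := hadd (p - h) h hpp hh (by rw [sub_mul, hph, hh, sub_self])
        (by rw [mul_sub, hhp, hh, sub_self])
      have h5 : rk h = r := by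
        rw [← hr i, ← hxy, ← hyx]
        exact hinv x y (by rw [hxy, hh]) (by rw [hyx, hcc])
      exact ⟨t + 1, by rw [← sub_add_cancel p h, h4, ht, h5, succ_nsmul]⟩
    · rw [hq] at hw hw'
      obtain ⟨h, hh, hqh, hhq, -, x', y', hxy', hyx'⟩ :=
        exists_idempotent_equiv_of_invertible_corner hcc f2 f4 f3 (by rw [add_comm, f5])
          hcG hGc hGG hw hw'
      have hhp : h * p = 0 := by rw [← hhq, mul_assoc, f4, mul_zero]
      have hph : p * h = 0 := by rw [← hqh, ← mul_assoc, f3, zero_mul]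
      have hqq : (q - h) * (q - h) = q - h := by
        simp only [mul_sub, sub_mul, f2, hqh, hhq, hh]; abel
      exact ih p (q - h) x' y' f1 hqq
        (by rw [mul_sub, f3, hph, sub_zero]) (by rw [sub_mul, f4, hhp, sub_zero])
        (by rw [hxy', ← f5]; abel) (by rw [hyx', hGs])

end KrullSchmidt

/-! ### Finite algebras over complete local rings -/

theorem IsAdicComplete.of_finite {R M : Type*} [CommRing R] [IsNoetherianRing R] (I : Ideal R)
    [IsAdicComplete I R] [AddCommGroup M] [Module R M] [Module.Finite R M] :
    IsAdicComplete I M := by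
  have := IsHausdorff.of_le_jacobson (M := M) I (IsAdicComplete.le_jacobson_bot I)
  have : IsPrecomplete I M := by
    rw [← AdicCompletion.of_surjective_iff]
    intro y
    obtain ⟨t, rfl⟩ := AdicCompletion.ofTensorProduct_surjective_of_finite I M y
    induction t using TensorProduct.induction_on with
    | zero => exact ⟨0, by simp⟩
    | tmul r x =>
      obtain ⟨r, rfl⟩ := AdicCompletion.of_surjective I R r
      refine ⟨r • x, ?_⟩
      rw [AdicCompletion.ofTensorProduct_tmul, map_smul]
      ext n
      simp
      rfl
    | add s t hs ht =>
      obtain ⟨x, hx⟩ := hs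
      obtain ⟨y, hy⟩ := ht
      exact ⟨x + y, by rw [map_add, map_add, hx, hy]⟩
  exact ⟨⟩

theorem HenselianRing.exists_isIdempotentElem_sub_mem {A : Type*} [CommRing A] {I : Ideal A}
    [HenselianRing A I] {a : A} (ha : a * a - a ∈ I) : ∃ e : A, IsIdempotentElem e ∧ e - a ∈ I := by
  obtain ⟨e, he, hea⟩ := HenselianRing.is_henselian (I := I)
    (Polynomial.X ^ 2 - Polynomial.X : Polynomial A)
    (Polynomial.monic_X_pow_sub (Polynomial.degree_X_le.trans_lt (by norm_num))) a
    (by simpa [pow_two] using ha) (by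
      have h : Polynomial.eval a (Polynomial.derivative (Polynomial.X ^ 2 - Polynomial.X)) =
        2 * a - 1 := by simp [one_add_one_eq_two]
      rw [h]
      refine IsUnit.of_mul_eq_one (Ideal.Quotient.mk I (2 * a - 1)) ?_
      rw [← map_mul, ← map_one (Ideal.Quotient.mk I), Ideal.Quotient.eq]
      -- The derivative `2 a - 1` is its own inverse modulo `I`.
      have : (2 * a - 1) * (2 * a - 1) - 1 = 4 * (a * a - a) := by ring
      rw [this]
      exact I.mul_mem_left _ ha)
  refine ⟨e, ?_, hea⟩
  have : e ^ 2 - e = 0 := by simpa [Polynomial.IsRoot] using he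
  rw [IsIdempotentElem, ← pow_two]
  exact sub_eq_zero.mp this

/-- In a commutative ring without nontrivial idempotents, henselian along an ideal `I` with artinian
quotient, one of `x` and `1 - x` is a unit: the powers of the ideal generated by `x` stabilize in
the quotient, so that `x ^ (n + 1) = x ^ (2 n + 2) y ^ (n + 1)` there for some `y`; then
`(x y) ^ (n + 1)` is an idempotent modulo `I`. It lifts to `0` or `1`, and so `x` is nilpotent or
invertible modulo `I`. -/
theorem isUnit_or_isUnit_one_sub_of_henselian {A : Type*} [CommRing A] (I : Ideal A)
    [HenselianRing A I] [IsArtinianRing (A ⧸ I)]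
    (hA : ∀ e : A, IsIdempotentElem e → e = 0 ∨ e = 1) (x : A) : IsUnit x ∨ IsUnit (1 - x) := by
  have := isLocalHom_of_le_jacobson_bot I HenselianRing.jac
  obtain ⟨n, y, hy⟩ := IsArtinian.exists_pow_succ_smul_dvd (Ideal.Quotient.mk I x) (1 : A ⧸ I)
  obtain ⟨y, rfl⟩ := Ideal.Quotient.mk_surjective y
  simp only [smul_eq_mul, mul_one] at hy
  have hN : ∀ j, Ideal.Quotient.mk I x ^ (n + 1) =
      Ideal.Quotient.mk I x ^ (n + 1 + j) * Ideal.Quotient.mk I y ^ j := by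
    intro j
    induction j with
    | zero => simp
    | succ j ih =>
      have : Ideal.Quotient.mk I x ^ (n + 1 + (j + 1)) * Ideal.Quotient.mk I y ^ (j + 1) =
          (Ideal.Quotient.mk I x ^ (n + 1) * Ideal.Quotient.mk I y) *
            (Ideal.Quotient.mk I x ^ (j + 1) * Ideal.Quotient.mk I y ^ j) := by ring
      rw [this, hy, ih]
      ring
  have h1 := hN (n + 1)
  obtain ⟨e, he, hex⟩ := HenselianRing.exists_isIdempotentElem_sub_mem (I := I)
    (a := (x * y) ^ (n + 1)) (by
      rw [← Ideal.Quotient.eq, map_mul, map_pow, map_mul]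
      rw [mul_pow]
      conv_rhs => rw [h1]
      ring)
  rw [← Ideal.Quotient.eq] at hex
  rcases hA e he with rfl | rfl
  · right
    refine isUnit_of_map_unit (Ideal.Quotient.mk I) _ ?_
    rw [map_sub, map_one]
    refine IsNilpotent.isUnit_one_sub ⟨n + 1, ?_⟩
    have h2 : Ideal.Quotient.mk I x ^ (n + 1 + (n + 1)) * Ideal.Quotient.mk I y ^ (n + 1) =
      Ideal.Quotient.mk I x ^ (n + 1) * Ideal.Quotient.mk I ((x * y) ^ (n + 1)) := by
        rw [map_pow, map_mul]; ring
    rw [h1, h2, ← hex, map_zero, mul_zero]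
  · left
    refine isUnit_of_map_unit (Ideal.Quotient.mk I) _ ?_
    refine IsUnit.of_mul_eq_one (Ideal.Quotient.mk I (x ^ n * y ^ (n + 1))) ?_
    rw [← map_mul, ← map_one (Ideal.Quotient.mk I), hex]
    congr 1
    ring

/-- In a module-finite, possibly noncommutative algebra without nontrivial idempotents over a
complete noetherian local ring, one of `x` and `1 - x` is a unit. -/
theorem isUnit_or_isUnit_one_sub_of_isAdicComplete {R B : Type*} [CommRing R] [IsLocalRing R]
    [IsNoetherianRing R] [IsAdicComplete (IsLocalRing.maximalIdeal R) R] [Ring B] [Algebra R B]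
    [Module.Finite R B] (hB : ∀ e : B, IsIdempotentElem e → e = 0 ∨ e = 1) (x : B) :
    IsUnit x ∨ IsUnit (1 - x) := by
  -- The subalgebra generated by `x` is commutative, finite, and thus complete.
  let A := Algebra.adjoin R {x}
  have : IsMulCommutative A := Algebra.isMulCommutative_adjoin R (by
    intro a ha b hb
    rw [Set.mem_singleton_iff.mp ha, Set.mem_singleton_iff.mp hb])
  have : Module.Finite R A :=
    inferInstanceAs (Module.Finite R (Subalgebra.toSubmodule (Algebra.adjoin R {x})))
  have : IsAdicComplete (IsLocalRing.maximalIdeal R) A := .of_finite _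
  let I := (IsLocalRing.maximalIdeal R).map (algebraMap R A)
  have : IsAdicComplete I A := (IsAdicComplete.map_algebraMap_iff _ _).mpr inferInstance
  have : IsArtinianRing (A ⧸ I) := by
    have : IsArtinianRing (R ⧸ IsLocalRing.maximalIdeal R) :=
      inferInstanceAs (IsArtinianRing (IsLocalRing.ResidueField R))
    have : IsScalarTower R (R ⧸ IsLocalRing.maximalIdeal R) (A ⧸ I) := inferInstance
    have : Module.Finite (R ⧸ IsLocalRing.maximalIdeal R) (A ⧸ I) :=
      Module.Finite.of_restrictScalars_finite R _ _
    exact IsArtinianRing.of_finite (R ⧸ IsLocalRing.maximalIdeal R) (A ⧸ I)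
  have := isUnit_or_isUnit_one_sub_of_henselian I (fun e he => ?_)
    (⟨x, Algebra.subset_adjoin rfl⟩ : A)
  · refine this.imp (fun h => ?_) (fun h => ?_)
    · exact h.map A.val
    · exact h.map A.val
  · refine (hB e.1 (congrArg Subtype.val he)).imp (fun h => Subtype.ext h) (fun h => Subtype.ext h)

/-! ### Endomorphisms and summands of matrix factorizations -/

section GradedEndomorphisms

variable {R : Type*} [CommRing R] {d : ℕ} {V : ZMod d → Type*} [∀ k, AddCommGroup (V k)]
  [∀ k, Module R (V k)]

/-- The algebra of degree zero endomorphisms of a family of modules `V_k`, `k ∈ ℤ/d`, which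
commute with given maps `V_{k+1} → V_k`. -/
def gradedEnd (φ : ∀ k : ZMod d, V (k + 1) →ₗ[R] V k) :
    Subalgebra R (∀ k, Module.End R (V k)) where
  carrier := {e | ∀ k x, e k (φ k x) = φ k (e (k + 1) x)}
  mul_mem' {a b} ha hb k x := by
    change a k (b k (φ k x)) = φ k (a (k + 1) (b (k + 1) x))
    rw [hb, ha]
  add_mem' {a b} ha hb k x := by
    change a k (φ k x) + b k (φ k x) = φ k (a (k + 1) x + b (k + 1) x)
    rw [hb, ha, map_add]
  algebraMap_mem' r k x := by
    change r • φ k x = φ k (r • x)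
    rw [map_smul]

end GradedEndomorphisms

theorem LinearMap.projective_range_of_isIdempotentElem {R M : Type*} [CommRing R] [AddCommGroup M]
    [Module R M] [Module.Projective R M] {e : Module.End R M} (he : IsIdempotentElem e) :
    Module.Projective R (LinearMap.range e) :=
  Module.Projective.of_split (LinearMap.range e).subtype (LinearMap.rangeRestrict e) (by
    ext ⟨_, x, rfl⟩
    exact LinearMap.congr_fun he x)

namespace MatFac

section Summands

variable {Q : Type u} [CommRing Q] {d : ℕ} [NeZero d] {f : Q}

/-- The image of an idempotent endomorphism of a matrix factorization. -/
def image (X : MatFac Q d f) (e : ∀ k, Module.End Q (X.obj k)) (he : e ∈ gradedEnd X.φ)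
    (hi : ∀ k, IsIdempotentElem (e k)) : MatFac Q d f where
  obj k := LinearMap.range (e k)
  projective k := LinearMap.projective_range_of_isIdempotentElem (hi k)
  φ k := (X.φ k).restrict (by
    rintro _ ⟨x, rfl⟩
    exact ⟨X.φ k x, he k x⟩)
  pow_eq := by
    refine LinearMap.ext fun x => funext fun k => Subtype.ext ?_
    have h := pow_intertwine
      (LinearMap.pi fun k => (LinearMap.range (e k)).subtype.comp (LinearMap.proj k))
      (LinearMap.pi fun k => ((X.φ k).restrict (p := LinearMap.range (e (k + 1)))
        (q := LinearMap.range (e k)) (by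
          rintro _ ⟨x, rfl⟩
          exact ⟨X.φ k x, he k x⟩)).comp (LinearMap.proj (k + 1)))
      X.total (fun _ => rfl) d x
    rw [total_pow] at h
    exact congrFun h k

/-- An idempotent endomorphism splits a matrix factorization into its image and the image of the
complementary idempotent. -/
def isoImageProd (X : MatFac Q d f) (e : ∀ k, Module.End Q (X.obj k)) (he : e ∈ gradedEnd X.φ)
    (hi : ∀ k, IsIdempotentElem (e k)) :
    Iso X ((X.image e he hi).prod (X.image (1 - e) (sub_mem (one_mem _) he)
      fun k => (hi k).one_sub)) where
  e k := LinearEquiv.ofLinearMap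
    ((LinearMap.rangeRestrict (e k)).prod (LinearMap.rangeRestrict ((1 - e) k)))
    ((LinearMap.range (e k)).subtype.coprod (LinearMap.range ((1 - e) k)).subtype)
    (by
      have h : ∀ x, e k (e k x) = e k x := fun x => LinearMap.congr_fun (hi k) x
      refine LinearMap.ext ?_
      rintro ⟨⟨_, x, rfl⟩, ⟨_, y, rfl⟩⟩
      refine Prod.ext (Subtype.ext ?_) (Subtype.ext ?_)
      · change e k (e k x + (y - e k y)) = e k x
        simp [h]
      · change e k x + (y - e k y) - e k (e k x + (y - e k y)) = y - e k y
        simp [h])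
    (by
      refine LinearMap.ext fun x => ?_
      change e k x + (x - e k x) = x
      abel)
  comm k x := by
    refine Prod.ext (Subtype.ext ?_) (Subtype.ext ?_)
    · exact he k x
    · exact sub_mem (one_mem _) he k x

theorem Indecomposable.eq_zero_or_eq_one {X : MatFac Q d f} (hX : X.Indecomposable)
    (e : gradedEnd X.φ) (hi : IsIdempotentElem e) : e = 0 ∨ e = 1 := by
  obtain ⟨e, he⟩ := e
  have hi' : ∀ k, IsIdempotentElem (e k) := fun k => congrFun (congrArg Subtype.val hi) k
  refine (hX.2 _ _ ⟨X.isoImageProd e he hi'⟩).imp (fun h => ?_) (fun h => ?_)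
  · refine Subtype.ext (funext fun k => LinearMap.range_eq_bot.mp ?_)
    exact (Submodule.subsingleton_iff_eq_bot).mp (h k)
  · refine Subtype.ext (funext fun k => (sub_eq_zero.mp ?_).symm)
    exact LinearMap.range_eq_bot.mp ((Submodule.subsingleton_iff_eq_bot).mp (h k))

/-- Over a complete noetherian local ring, an indecomposable matrix factorization has a local
endomorphism ring. -/
theorem Indecomposable.isUnit_or_isUnit_one_sub [IsLocalRing Q] [IsNoetherianRing Q]
    [IsAdicComplete (IsLocalRing.maximalIdeal Q) Q] {X : MatFac Q d f} (hX : X.Indecomposable)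
    (x : gradedEnd X.φ) : IsUnit x ∨ IsUnit (1 - x) := by
  have h1 : ∀ k, Module.Finite Q (Module.End Q (X.obj k)) := fun k => inferInstance
  have : Module.Finite Q (gradedEnd X.φ) :=
    inferInstanceAs (Module.Finite Q (Subalgebra.toSubmodule (gradedEnd X.φ)))
  exact isUnit_or_isUnit_one_sub_of_isAdicComplete (R := Q) hX.eq_zero_or_eq_one x

end Summands

section Decomposition

variable {Q : Type u} [CommRing Q] {d : ℕ} [NeZero d] {f : Q}

/-- If `X` is isomorphic to `A ⊕ B`, decompositions of `A` and `B` give one of `X`, as the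
direct sum of two direct sums is the direct sum over the disjoint
union. -/
def isoDirectSumOfProd {X A B : MatFac Q d f} {N N' : ℕ} {Z : Fin N → MatFac Q d f}
    {Z' : Fin N' → MatFac Q d f} (i : Iso X (A.prod B)) (iA : Iso A (directSum Z))
    (iB : Iso B (directSum Z')) :
    Iso X (directSum fun j => Sum.elim Z Z' (finSumFinEquiv.symm j)) where
  e k := (i.e k).trans (((iA.e k).prodCongr (iB.e k)).trans
    ((LinearEquiv.sumPiEquivProdPi Q (Fin N) (Fin N') (fun j => (Sum.elim Z Z' j).obj k)).symm.trans
      (LinearEquiv.piCongrLeft' Q (fun j => (Sum.elim Z Z' j).obj k) finSumFinEquiv)))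
  comm k x := by
    refine funext fun j => ?_
    have h := i.comm k x
    change (Sum.rec (motive := fun j => (Sum.elim Z Z' j).obj k) (iA.e k (i.e k (X.φ k x)).1)
      (iB.e k (i.e k (X.φ k x)).2) (finSumFinEquiv.symm j)) =
      (Sum.elim Z Z' (finSumFinEquiv.symm j)).φ k
        (Sum.rec (motive := fun j => (Sum.elim Z Z' j).obj (k + 1)) (iA.e (k + 1) (i.e (k + 1) x).1)
          (iB.e (k + 1) (i.e (k + 1) x).2) (finSumFinEquiv.symm j))
    rw [h]
    generalize finSumFinEquiv.symm j = j'
    cases j' with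
    | inl j => exact congrFun (iA.comm k _) j
    | inr j => exact congrFun (iB.comm k _) j

theorem IsZero.decomposesInto {X : MatFac Q d f} (hX : X.IsZero) : X.DecomposesInto 0 := by
  refine ⟨fun i => i.elim0, fun i => i.elim0, ⟨⟨fun k => ?_, fun k x => ?_⟩⟩⟩
  · have := hX k
    have : Subsingleton ((directSum fun i : Fin 0 => (i.elim0 : MatFac Q d f)).obj k) :=
      inferInstanceAs (Subsingleton (∀ i : Fin 0, (i.elim0 : MatFac Q d f).obj k))
    exact
      { toFun := 0, map_add' := by simp, map_smul' := by simp, invFun := 0,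
        left_inv := fun _ => Subsingleton.elim _ _, right_inv := fun _ => Subsingleton.elim _ _ }
  · exact funext fun i => i.elim0

theorem Indecomposable.decomposesInto {X : MatFac Q d f} (hX : X.Indecomposable) :
    X.DecomposesInto 1 :=
  ⟨fun _ => X, fun _ => hX, ⟨⟨fun k => (LinearEquiv.funUnique (Fin 1) Q (X.obj k)).symm,
    fun _ _ => rfl⟩⟩⟩

/-- Every matrix factorization over a local ring is a finite direct sum of indecomposable ones, by
induction on the total rank. -/
theorem exists_decomposesInto [IsLocalRing Q] (X : MatFac Q d f) :
    ∃ N, X.DecomposesInto N := by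
  obtain ⟨r, hr⟩ : ∃ r, r = ∑ k, Module.finrank Q (X.obj k) := ⟨_, rfl⟩
  induction r using Nat.strong_induction_on generalizing X with
  | _ r ih =>
  by_cases h0 : X.IsZero
  · exact ⟨0, h0.decomposesInto⟩
  by_cases h1 : X.Indecomposable
  · exact ⟨1, h1.decomposesInto⟩
  have : ∃ A B : MatFac Q d f, Nonempty (Iso X (A.prod B)) ∧ ¬ A.IsZero ∧ ¬ B.IsZero := by
    by_contra! h
    exact h1 ⟨h0, fun A B hAB => or_iff_not_imp_left.mpr (h A B hAB)⟩
  obtain ⟨A, B, ⟨i⟩, hA, hB⟩ := this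
  have hfree : ∀ (Z : MatFac Q d f) k, Module.Free Q (Z.obj k) := fun Z k =>
    Module.free_of_flat_of_isLocalRing
  have hpos : ∀ Z : MatFac Q d f, ¬ Z.IsZero → 0 < ∑ k, Module.finrank Q (Z.obj k) := by
    intro Z hZ
    obtain ⟨k, hk⟩ := not_forall.mp hZ
    rw [not_subsingleton_iff_nontrivial] at hk
    have := hfree Z k
    exact ((Module.finrank_pos_iff_of_free Q (Z.obj k)).mpr hk).trans_le
      (Finset.single_le_sum (f := fun k => Module.finrank Q (Z.obj k))
        (fun _ _ => Nat.zero_le _) (Finset.mem_univ k))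
  have hsum : r = ∑ k, Module.finrank Q (A.obj k) + ∑ k, Module.finrank Q (B.obj k) := by
    rw [hr, ← Finset.sum_add_distrib]
    refine Finset.sum_congr rfl fun k _ => ?_
    have := hfree A k
    have := hfree B k
    rw [← Module.finrank_prod]
    exact (i.e k).finrank_eq
  have hA' := hpos A hA
  have hB' := hpos B hB
  obtain ⟨N, Z, hZ, ⟨iA⟩⟩ := ih _ (by omega) A rfl
  obtain ⟨N', Z', hZ', ⟨iB⟩⟩ := ih _ (by omega) B rfl
  refine ⟨N + N', _, fun j => ?_, ⟨isoDirectSumOfProd i iA iB⟩⟩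
  rcases finSumFinEquiv.symm j with j | j
  · exact hZ j
  · exact hZ' j

end Decomposition

end MatFac

/-! ### Ranks of idempotents, and sums of shifts -/

section RangeRank

variable {R M W : Type*} [CommRing R] [AddCommGroup M] [Module R M] [AddCommGroup W] [Module R W]

theorem LinearMap.finrank_range_comp_of_leftInverse (i : W →ₗ[R] M) (p : M →ₗ[R] W)
    (h : p ∘ₗ i = LinearMap.id) :
    Module.finrank R (LinearMap.range (i ∘ₗ p)) = Module.finrank R W := by
  have hpi : Function.LeftInverse p i := LinearMap.congr_fun h
  rw [LinearMap.range_comp_of_range_eq_top _ (LinearMap.range_eq_top.mpr hpi.surjective)]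
  exact (LinearEquiv.ofInjective i hpi.injective).finrank_eq.symm

theorem LinearMap.finrank_range_mul_comm {a b : Module.End R M} (hab : IsIdempotentElem (a * b))
    (hba : IsIdempotentElem (b * a)) :
    Module.finrank R (LinearMap.range (a * b)) = Module.finrank R (LinearMap.range (b * a)) := by
  have h1 : a * b = (a ∘ₗ (LinearMap.range (b * a)).subtype) ∘ₗ ((b * a).rangeRestrict ∘ₗ b) := by
    rw [← hab]
    rfl
  rw [h1]
  refine LinearMap.finrank_range_comp_of_leftInverse _ _ (LinearMap.ext ?_)
  rintro ⟨_, x, rfl⟩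
  refine Subtype.ext ?_
  exact (LinearMap.congr_fun (congrArg (· * (b * a)) hba) x).trans (LinearMap.congr_fun hba x)

theorem LinearMap.finrank_range_add_of_orthogonal [IsLocalRing R] [Module.Finite R M]
    [Module.Projective R M] {e f : Module.End R M} (he : IsIdempotentElem e)
    (hf : IsIdempotentElem f) (hef : e * f = 0) (hfe : f * e = 0) :
    Module.finrank R (LinearMap.range (e + f)) =
      Module.finrank R (LinearMap.range e) + Module.finrank R (LinearMap.range f) := by
  have := LinearMap.projective_range_of_isIdempotentElem he
  have := LinearMap.projective_range_of_isIdempotentElem hf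
  have : Module.Free R (LinearMap.range e) := Module.free_of_flat_of_isLocalRing
  have : Module.Free R (LinearMap.range f) := Module.free_of_flat_of_isLocalRing
  rw [← Module.finrank_prod]
  refine LinearMap.finrank_range_comp_of_leftInverse
    ((LinearMap.range e).subtype.coprod (LinearMap.range f).subtype)
    (e.rangeRestrict.prod f.rangeRestrict) (LinearMap.ext ?_)
  have h1 : ∀ x, e (e x) = e x := LinearMap.congr_fun he
  have h2 : ∀ x, f (f x) = f x := LinearMap.congr_fun hf
  have h3 : ∀ x, e (f x) = 0 := LinearMap.congr_fun hef
  have h4 : ∀ x, f (e x) = 0 := LinearMap.congr_fun hfe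
  rintro ⟨⟨_, x, rfl⟩, ⟨_, y, rfl⟩⟩
  refine Prod.ext (Subtype.ext ?_) (Subtype.ext ?_)
  · change e (e x + f y) = e x
    rw [map_add, h1, h3, add_zero]
  · change f (e x + f y) = f y
    rw [map_add, h2, h4, zero_add]

end RangeRank

section ShiftSum

variable {R : Type*} [CommRing R] {d : ℕ} {V : ZMod d → Type*} [∀ k, AddCommGroup (V k)]
  [∀ k, Module R (V k)]

/-- The degree `k` part of the direct sum of the shifts `V[-j]`, `j ∈ ℤ/d`, each of them taken
with multiplicity `ι`. It is indexed by pairs `i + j = k`, as in `MatFac.TensorObj`, so that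
no transport between `V (k + 1 - j)` and `V (k - j + 1)` is needed. -/
abbrev ShiftObj (V : ZMod d → Type*) (ι : Type*) (k : ZMod d) :=
  ∀ p : {p : ZMod d × ZMod d // p.1 + p.2 = k}, ι → V p.1.1

/-- The structure map of the direct sum of the shifts of `(V, φ)`, where `φ` is multiplied by
`u j` on the summands `V[-j]`. -/
def shiftMap (φ : ∀ k : ZMod d, V (k + 1) →ₗ[R] V k) (u : ZMod d → R) (ι : Type*) (k : ZMod d) :
    ShiftObj V ι (k + 1) →ₗ[R] ShiftObj V ι k :=
  LinearMap.pi fun p => LinearMap.pi fun l =>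
    u p.1.2 • (φ p.1.1 ∘ₗ LinearMap.proj l ∘ₗ LinearMap.proj
      (⟨(p.1.1 + 1, p.1.2), by linear_combination p.2⟩ :
        {q : ZMod d × ZMod d // q.1 + q.2 = k + 1}))

variable {ι : Type*} [DecidableEq ι]

/-- An endomorphism of `(V, φ)`, acting on one of the summands `V[-j]` of the sum of all shifts
and by zero on the others; the summand is given by `j` and a copy in `ι`. -/
def shiftDiag (c : ZMod d × ι) (x : ∀ k, Module.End R (V k)) (k : ZMod d) :
    Module.End R (ShiftObj V ι k) :=
  LinearMap.pi fun p => LinearMap.pi fun l =>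
    if (p.1.2, l) = c then x p.1.1 ∘ₗ LinearMap.proj l ∘ₗ LinearMap.proj p else 0

theorem shiftDiag_apply (c : ZMod d × ι) (x : ∀ k, Module.End R (V k)) (k : ZMod d)
    (v : ShiftObj V ι k) (p : {p : ZMod d × ZMod d // p.1 + p.2 = k}) (l : ι) :
    shiftDiag c x k v p l = if (p.1.2, l) = c then x p.1.1 (v p l) else 0 := by
  simp only [shiftDiag, LinearMap.pi_apply]
  split_ifs <;> rfl

/-- The diagonal entry of an endomorphism of the sum of all shifts at one of the summands. -/
def shiftEntry (c : ZMod d × ι) (y : ∀ k, Module.End R (ShiftObj V ι k)) (i : ZMod d) :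
    Module.End R (V i) :=
  LinearMap.proj c.2 ∘ₗ
    LinearMap.proj (⟨(i, c.1), rfl⟩ : {p : ZMod d × ZMod d // p.1 + p.2 = i + c.1}) ∘ₗ
    y (i + c.1) ∘ₗ LinearMap.single R _ ⟨(i, c.1), rfl⟩ ∘ₗ
    LinearMap.single R (fun _ => V i) c.2

theorem shiftEntry_apply (y : ∀ k, Module.End R (ShiftObj V ι k)) (k : ZMod d)
    (p : {p : ZMod d × ZMod d // p.1 + p.2 = k}) (l : ι) (x : V p.1.1) :
    shiftEntry (p.1.2, l) y p.1.1 x = y k (Pi.single p (Pi.single l x)) p l := by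
  obtain ⟨⟨i, j⟩, rfl⟩ := p
  rfl

variable {φ : ∀ k : ZMod d, V (k + 1) →ₗ[R] V k} {u : ZMod d → R}

theorem shiftDiag_mem (c : ZMod d × ι) {x : ∀ k, Module.End R (V k)} (hx : x ∈ gradedEnd φ) :
    shiftDiag c x ∈ gradedEnd (shiftMap φ u ι) := by
  intro k v
  refine funext fun p => funext fun l => ?_
  rw [shiftDiag_apply]
  change (if _ then x p.1.1 (u p.1.2 • φ p.1.1 _) else 0) =
    u p.1.2 • φ p.1.1 (shiftDiag c x (k + 1) v ⟨(p.1.1 + 1, p.1.2), _⟩ l)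
  rw [shiftDiag_apply]
  split_ifs
  · rw [map_smul, hx]
    rfl
  · simp

/-- The scalars have to be units: on `V[-j]` the structure map is `u j • φ`, and an endomorphism
commuting with it has to commute with `φ`. -/
theorem shiftEntry_mem (hu : ∀ j, IsUnit (u j)) (c : ZMod d × ι)
    {y : ∀ k, Module.End R (ShiftObj V ι k)} (hy : y ∈ gradedEnd (shiftMap φ u ι)) :
    shiftEntry c y ∈ gradedEnd φ := by
  obtain ⟨j, l⟩ := c
  intro i x
  have h := congrFun (congrFun (hy (i + j)
    (Pi.single ⟨(i + 1, j), by ring⟩ (Pi.single l x))) ⟨(i, j), rfl⟩) l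
  have h1 : shiftMap φ u ι (i + j) (Pi.single ⟨(i + 1, j), by ring⟩ (Pi.single l x)) =
      u j • Pi.single ⟨(i, j), rfl⟩ (Pi.single l (φ i x)) := by
    refine funext fun p => funext fun l' => ?_
    obtain ⟨⟨i', j'⟩, hp⟩ := p
    change u j' • φ i' ((Pi.single (⟨(i + 1, j), _⟩ :
      {q : ZMod d × ZMod d // q.1 + q.2 = i + j + 1}) (Pi.single l x) :
        ShiftObj V ι (i + j + 1)) ⟨(i' + 1, j'), _⟩ l') = u j • (Pi.single ⟨(i, j), rfl⟩
          (Pi.single l (φ i x)) : ShiftObj V ι (i + j)) ⟨(i', j'), hp⟩ l'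
    by_cases hj : j' = j
    · subst hj
      obtain rfl : i' = i := add_right_cancel hp
      rw [Pi.single_eq_same, Pi.single_eq_same]
      by_cases hl : l' = l
      · subst hl; simp
      · simp [Pi.single_eq_of_ne hl]
    · rw [Pi.single_eq_of_ne (fun h => hj (congrArg (fun q => q.1.2) h)),
        Pi.single_eq_of_ne (fun h => hj (congrArg (fun q => q.1.2) h))]
      simp
  rw [h1, map_smul] at h
  refine ((hu j).smul_left_cancel).mp ?_
  refine h.trans ?_
  change u j • φ i _ = _
  congr 2
  exact (shiftEntry_apply y (i + j + 1) ⟨(i + 1, j), by ring⟩ l x).symm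

theorem shiftDiag_mul (c : ZMod d × ι) (x y : ∀ k, Module.End R (V k)) :
    shiftDiag c x * shiftDiag c y = shiftDiag c (x * y) := by
  refine funext fun k => LinearMap.ext fun v => funext fun p => funext fun l => ?_
  change shiftDiag c x k (shiftDiag c y k v) p l = _
  simp only [shiftDiag_apply]
  split_ifs <;> rfl

theorem shiftDiag_mul_of_ne {c c' : ZMod d × ι} (h : c ≠ c') (x y : ∀ k, Module.End R (V k)) :
    shiftDiag c x * shiftDiag c' y = 0 := by
  refine funext fun k => LinearMap.ext fun v => funext fun p => funext fun l => ?_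
  change shiftDiag c x k (shiftDiag c' y k v) p l = 0
  simp only [shiftDiag_apply]
  split_ifs with h1 h2
  · exact absurd (h1.symm.trans h2) h
  · simp
  · rfl

theorem shiftDiag_sub (c : ZMod d × ι) (x y : ∀ k, Module.End R (V k)) :
    shiftDiag c (x - y) = shiftDiag c x - shiftDiag c y := by
  refine funext fun k => LinearMap.ext fun v => funext fun p => funext fun l => ?_
  change _ = shiftDiag c x k v p l - shiftDiag c y k v p l
  simp only [shiftDiag_apply]
  split_ifs
  · rfl
  · simp

theorem sum_shiftDiag_one [NeZero d] [Fintype ι] :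
    ∑ c : ZMod d × ι, shiftDiag (R := R) (V := V) c 1 = 1 := by
  refine funext fun k => LinearMap.ext fun v => funext fun p => funext fun l => ?_
  simp only [Finset.sum_apply, LinearMap.sum_apply, shiftDiag_apply]
  simp

/-- The projection operator onto the summand `c` of the sum of all shifts factors through the
corresponding degree `V (k - c.1)` of `V`. -/
theorem shiftDiag_one_eq_comp (c : ZMod d × ι) (k : ZMod d) :
    shiftDiag (R := R) (V := V) c 1 k =
      (LinearMap.single R _ (⟨(k - c.1, c.1), sub_add_cancel _ _⟩ :
        {p : ZMod d × ZMod d // p.1 + p.2 = k}) ∘ₗ LinearMap.single R _ c.2) ∘ₗ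
      (LinearMap.proj c.2 ∘ₗ LinearMap.proj (⟨(k - c.1, c.1), sub_add_cancel _ _⟩ :
        {p : ZMod d × ZMod d // p.1 + p.2 = k})) := by
  refine LinearMap.ext fun v => funext fun p => funext fun l => ?_
  rw [shiftDiag_apply]
  change _ = (Pi.single _ (Pi.single c.2 (v ⟨(k - c.1, c.1), sub_add_cancel _ _⟩ c.2)) :
    ShiftObj V ι k) p l
  obtain ⟨j, l₀⟩ := c
  by_cases hj : p.1.2 = j
  · have hp : p = ⟨(k - j, j), sub_add_cancel _ _⟩ := by
      refine Subtype.ext (Prod.ext ?_ hj)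
      exact eq_sub_of_add_eq (hj ▸ p.2)
    subst hp
    rw [Pi.single_eq_same]
    by_cases hl : l = l₀
    · subst hl; simp
    · simp [hl]
  · rw [Pi.single_eq_of_ne (fun h => hj (congrArg (fun q => q.1.2) h))]
    simp [hj]

theorem finrank_range_shiftDiag_one (c : ZMod d × ι) (k : ZMod d) :
    Module.finrank R (LinearMap.range (shiftDiag (R := R) (V := V) c 1 k)) =
      Module.finrank R (V (k - c.1)) := by
  rw [shiftDiag_one_eq_comp]
  refine LinearMap.finrank_range_comp_of_leftInverse _ _ (LinearMap.ext fun x => ?_)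
  simp

theorem shiftDiag_one_mul_mul (c : ZMod d × ι) (y : ∀ k, Module.End R (ShiftObj V ι k)) :
    shiftDiag c 1 * y * shiftDiag c 1 = shiftDiag c (shiftEntry c y) := by
  refine funext fun k => LinearMap.ext fun v => funext fun p => funext fun l => ?_
  change shiftDiag c 1 k (y k (shiftDiag c 1 k v)) p l = _
  rw [shiftDiag_apply, shiftDiag_apply]
  split_ifs with h
  · subst h
    rw [shiftEntry_apply, shiftDiag_one_eq_comp]
    have hp : (⟨(k - p.1.2, p.1.2), sub_add_cancel _ _⟩ :
        {p : ZMod d × ZMod d // p.1 + p.2 = k}) = p :=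
      Subtype.ext (Prod.ext (eq_sub_of_add_eq p.2).symm rfl)
    change y k (Pi.single _ (Pi.single l (v ⟨(k - p.1.2, p.1.2), sub_add_cancel _ _⟩ l))) p l = _
    rw [hp]
  · rfl

/-- If `(V, φ)` has a local endomorphism ring and constant rank `n`, then every direct summand of
a finite direct sum of shifts of `(V, φ)` has constant rank, and this rank is a multiple of `n`. -/
theorem exists_finrank_eq_mul_of_shift_summand [IsLocalRing R] [NeZero d] [Finite ι]
    [∀ k, Module.Finite R (V k)] [∀ k, Module.Free R (V k)]
    (hloc : ∀ x : gradedEnd φ, IsUnit x ∨ IsUnit (1 - x)) (hu : ∀ j, IsUnit (u j)) {n : ℕ}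
    (hn : ∀ k, Module.finrank R (V k) = n)
    {W : ZMod d → Type*} [∀ k, AddCommGroup (W k)] [∀ k, Module R (W k)]
    (ψ : ∀ k : ZMod d, W (k + 1) →ₗ[R] W k) (i : ∀ k, W k →ₗ[R] ShiftObj V ι k)
    (p : ∀ k, ShiftObj V ι k →ₗ[R] W k)
    (hi : ∀ k x, i k (ψ k x) = shiftMap φ u ι k (i (k + 1) x))
    (hp : ∀ k x, p k (shiftMap φ u ι k x) = ψ k (p (k + 1) x))
    (hpi : ∀ k, p k ∘ₗ i k = LinearMap.id) :
    ∃ t : ℕ, ∀ k, Module.finrank R (W k) = t * n := by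
  classical
  cases nonempty_fintype ι
  let e : gradedEnd (shiftMap φ u ι) := ⟨fun k => i k ∘ₗ p k, fun k x => by
    change i k (p k _) = shiftMap φ u ι k (i (k + 1) (p (k + 1) x))
    rw [hp, hi]⟩
  have he : e * e = e := by
    refine Subtype.ext (funext fun k => LinearMap.ext fun x => ?_)
    change i k (p k (i k (p k x))) = i k (p k x)
    rw [show p k (i k (p k x)) = p k x from LinearMap.congr_fun (hpi k) _]
  let c : ZMod d × ι → gradedEnd (shiftMap φ u ι) := fun c =>
    ⟨shiftDiag c 1, shiftDiag_mem c (one_mem _)⟩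
  have hc : OrthogonalIdempotents c :=
    ⟨fun a => Subtype.ext ((shiftDiag_mul a 1 1).trans (by rw [mul_one])),
      fun a b hab => Subtype.ext (shiftDiag_mul_of_ne hab 1 1)⟩
  have key : ∀ (a : ZMod d × ι) (z : gradedEnd φ) (y : gradedEnd (shiftMap φ u ι)),
      y.1 = shiftDiag a z.1 → IsUnit z → ∃ w, w * y = c a ∧ y * w = c a := by
    rintro a _ y hy ⟨z, rfl⟩
    refine ⟨⟨shiftDiag a (z⁻¹ : (gradedEnd φ)ˣ).1.1, shiftDiag_mem a (z⁻¹).1.2⟩,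
      Subtype.ext ?_, Subtype.ext ?_⟩
    · change _ * y.1 = shiftDiag a 1
      rw [hy, shiftDiag_mul]
      exact congrArg (shiftDiag a) (congrArg Subtype.val z.inv_mul)
    · change y.1 * _ = shiftDiag a 1
      rw [hy, shiftDiag_mul]
      exact congrArg (shiftDiag a) (congrArg Subtype.val z.mul_inv)
  have hcorner : ∀ (a : ZMod d × ι) (x : gradedEnd (shiftMap φ u ι)),
      (∃ w, w * (c a * x * c a) = c a ∧ c a * x * c a * w = c a) ∨
        ∃ w, w * (c a - c a * x * c a) = c a ∧ (c a - c a * x * c a) * w = c a := by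
    intro a x
    have h1 := shiftDiag_one_mul_mul a x.1
    refine (hloc ⟨shiftEntry a x.1, shiftEntry_mem hu a x.2⟩).imp (key a _ _ h1) (key a _ _ ?_)
    change shiftDiag a 1 - shiftDiag a 1 * x.1 * shiftDiag a 1 =
      shiftDiag a (1 - shiftEntry a x.1)
    rw [h1, shiftDiag_sub]
  obtain ⟨t, ht⟩ := exists_nsmul_eq_of_local_corners (E := gradedEnd (shiftMap φ u ι))
    (fun (x : gradedEnd (shiftMap φ u ι)) (k : ZMod d) =>
      Module.finrank R (LinearMap.range (x.1 k)))
    (fun x y hx hy hxy hyx => funext fun k => LinearMap.finrank_range_add_of_orthogonal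
      (congrFun (congrArg Subtype.val hx) k) (congrFun (congrArg Subtype.val hy) k)
      (congrFun (congrArg Subtype.val hxy) k) (congrFun (congrArg Subtype.val hyx) k))
    (fun x y hxy hyx => funext fun k => LinearMap.finrank_range_mul_comm
      (congrFun (congrArg Subtype.val hxy) k) (congrFun (congrArg Subtype.val hyx) k))
    (fun _ => n) c hc
    (fun a => funext fun k => (finrank_range_shiftDiag_one a k).trans (hn _))
    hcorner
    Finset.univ e (1 - e) 1 1 he (by rw [mul_sub, sub_mul, sub_mul, he]; simp)
    (by rw [mul_sub, he]; simp) (by rw [sub_mul, he]; simp) (by simp)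
    (by
      refine Subtype.ext ?_
      rw [AddSubmonoidClass.coe_finsetSum, mul_one]
      exact sum_shiftDiag_one.symm)
  refine ⟨t, fun k => ?_⟩
  have := congrFun ht k
  rw [← LinearMap.finrank_range_comp_of_leftInverse (i k) (p k) (hpi k)]
  simpa using this

end ShiftSum

/-! ### Restriction of the tensor product along a retraction -/

theorem LinearMap.ext_tmul {Q S M P : Type*} [CommRing Q] [CommRing S] [Algebra S Q]
    [AddCommGroup M] [Module S M] [AddCommGroup P] [Module Q P] {α β : Q ⊗[S] M →ₗ[Q] P}
    (h : ∀ r x, α (r ⊗ₜ x) = β (r ⊗ₜ x)) : α = β := by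
  refine LinearMap.ext fun x => ?_
  induction x using TensorProduct.induction_on with
  | zero => rw [map_zero, map_zero]
  | tmul r x => exact h r x
  | add v w hv hw => rw [map_add, map_add, hv, hw]

section Retraction

variable {Q₁ Q₂ S M N ι : Type*} [CommRing Q₁] [CommRing Q₂] [CommRing S] [Algebra Q₁ S]
  [Algebra Q₂ S] [Algebra S Q₁] [AddCommGroup M] [Module Q₁ M]
  [AddCommGroup N] [Module Q₂ N]

theorem retractTensor_induction {p : Q₁ ⊗[S] ((S ⊗[Q₁] M) ⊗[S] (S ⊗[Q₂] N)) → Prop}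
    (h0 : p 0) (hadd : ∀ v w, p v → p w → p (v + w))
    (h : ∀ r s x s' y, p (r ⊗ₜ[S] ((s ⊗ₜ[Q₁] x) ⊗ₜ[S] (s' ⊗ₜ[Q₂] y)))) (w) : p w := by
  induction w using TensorProduct.induction_on with
  | zero => exact h0
  | add v w hv hw => exact hadd v w hv hw
  | tmul r t =>
  induction t using TensorProduct.induction_on with
  | zero => rwa [TensorProduct.tmul_zero]
  | add v w hv hw => rw [TensorProduct.tmul_add]; exact hadd _ _ hv hw
  | tmul v w =>
  induction v using TensorProduct.induction_on with
  | zero => rwa [TensorProduct.zero_tmul, TensorProduct.tmul_zero]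
  | add v v' hv hv' =>
    rw [TensorProduct.add_tmul, TensorProduct.tmul_add]; exact hadd _ _ hv hv'
  | tmul s x =>
  induction w using TensorProduct.induction_on with
  | zero => rwa [TensorProduct.tmul_zero, TensorProduct.tmul_zero]
  | add v v' hv hv' =>
    rw [TensorProduct.tmul_add, TensorProduct.tmul_add]; exact hadd _ _ hv hv'
  | tmul s' y => exact h r s x s' y

variable [IsScalarTower Q₁ S Q₁] [Fintype ι] [DecidableEq ι]

/-- Let `Q₁` be a retract of `S`, and let `N` be a free `Q₂`-module with basis `b`. Extending
`M` and `N` to `S`, tensoring over `S`, and restricting along the retraction `S → Q₁`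
yields one copy of `M` for each basis vector. -/
noncomputable def retractTensorEquiv (b : Module.Basis ι Q₂ N) :
    Q₁ ⊗[S] ((S ⊗[Q₁] M) ⊗[S] (S ⊗[Q₂] N)) ≃ₗ[Q₁] (ι → M) :=
  (LinearEquiv.baseChange S Q₁ _ _ ((TensorProduct.congr (LinearEquiv.refl S (S ⊗[Q₁] M))
      (b.baseChange S).equivFun).trans (TensorProduct.piScalarRight S S (S ⊗[Q₁] M) ι))).trans <|
    (TensorProduct.piRight S Q₁ Q₁ fun _ : ι => S ⊗[Q₁] M).trans <|
      LinearEquiv.piCongrRight fun _ =>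
        (TensorProduct.AlgebraTensorModule.cancelBaseChange Q₁ S Q₁ Q₁ M).trans
          (TensorProduct.lid Q₁ M)

theorem retractTensorEquiv_tmul (b : Module.Basis ι Q₂ N) (r : Q₁) (s s' : S) (x : M) (y : N)
    (l : ι) : retractTensorEquiv b (r ⊗ₜ[S] ((s ⊗ₜ[Q₁] x) ⊗ₜ[S] (s' ⊗ₜ[Q₂] y))) l =
      (algebraMap S Q₁ (algebraMap Q₂ S (b.repr y l) * s' * s) * r) • x := by
  simp [retractTensorEquiv, TensorProduct.smul_tmul', Algebra.smul_def, mul_assoc]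

variable {M' : Type*} [AddCommGroup M'] [Module Q₁ M']

theorem retractTensorEquiv_map_left (b : Module.Basis ι Q₂ N) (φ : M →ₗ[Q₁] M')
    (w : Q₁ ⊗[S] ((S ⊗[Q₁] M) ⊗[S] (S ⊗[Q₂] N))) (l : ι) :
    retractTensorEquiv b ((TensorProduct.map (φ.baseChange S) LinearMap.id).baseChange Q₁ w) l =
      φ (retractTensorEquiv b w l) := by
  induction w using retractTensor_induction with
  | h0 => simp
  | hadd v w hv hw => simp only [map_add, Pi.add_apply, hv, hw]
  | h r s x s' y =>
    rw [retractTensorEquiv_tmul, map_smul, LinearMap.baseChange_tmul, TensorProduct.map_tmul,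
      LinearMap.baseChange_tmul, LinearMap.id_apply, retractTensorEquiv_tmul]

variable {N' : Type*} [AddCommGroup N'] [Module Q₂ N']

/-- If the retraction kills the matrix entries of `ψ`, the map `id ⊗ ψ` restricts to zero. -/
theorem retractTensorEquiv_map_right (b : Module.Basis ι Q₂ N) (ψ : N' →ₗ[Q₂] N) (I : Ideal Q₂)
    (hψ : LinearMap.range ψ ≤ I • (⊤ : Submodule Q₂ N))
    (hI : ∀ c ∈ I, algebraMap S Q₁ (algebraMap Q₂ S c) = 0)
    (w : Q₁ ⊗[S] ((S ⊗[Q₁] M) ⊗[S] (S ⊗[Q₂] N'))) :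
    retractTensorEquiv b ((TensorProduct.map LinearMap.id (ψ.baseChange S)).baseChange Q₁ w) =
      0 := by
  induction w using retractTensor_induction with
  | h0 => simp
  | hadd v w hv hw => rw [map_add, map_add, hv, hw, add_zero]
  | h r s x s' y =>
    refine funext fun l => ?_
    rw [LinearMap.baseChange_tmul, TensorProduct.map_tmul, LinearMap.baseChange_tmul,
      LinearMap.id_apply, retractTensorEquiv_tmul, map_mul, map_mul, hI]
    · simp
    · have h := Submodule.mem_map_of_mem (f := b.coord l) (hψ ⟨y, rfl⟩)
      rw [Submodule.map_smul''] at h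
      exact Submodule.smul_le.mpr (fun r hr n _ => I.mul_mem_right n hr) h

end Retraction

namespace MatFac

section RankOfSummands

variable {Q S : Type u} [CommRing Q] [IsLocalRing Q] [IsNoetherianRing Q]
  [IsAdicComplete (IsLocalRing.maximalIdeal Q) Q] [CommRing S] [Algebra S Q] {d : ℕ} [NeZero d]
  {f : Q} {h : S} {ι : Type*} [Finite ι] {u : ZMod d → Q}

/-- If the base change of `T` to `Q` is a finite direct sum of shifts of an indecomposable matrix
factorization `X` of rank `n`, then direct summands of `T` have constant rank divisible by `n`. -/
theorem exists_finrank_eq_mul_of_baseChange_equiv [IsLocalRing S] {X : MatFac Q d f}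
    (hX : X.Indecomposable) {n : ℕ} (hn : X.HasRank n) (hu : ∀ j, IsUnit (u j)) {T : MatFac S d h}
    (θ : ∀ k, Q ⊗[S] T.obj k ≃ₗ[Q] ShiftObj X.obj ι k)
    (hθ : ∀ k x, θ k ((T.φ k).baseChange Q x) = shiftMap X.φ u ι k (θ (k + 1) x))
    {Z : MatFac S d h} (i : ∀ k, Z.obj k →ₗ[S] T.obj k) (p : ∀ k, T.obj k →ₗ[S] Z.obj k)
    (hi : ∀ k x, i k (Z.φ k x) = T.φ k (i (k + 1) x))
    (hp : ∀ k x, p k (T.φ k x) = Z.φ k (p (k + 1) x)) (hpi : ∀ k, p k ∘ₗ i k = LinearMap.id) :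
    ∃ t : ℕ, ∀ k, Module.finrank S (Z.obj k) = t * n := by
  classical
  have hfree : ∀ k, Module.Free Q (X.obj k) := fun k => (hn k).1
  have hi' : ∀ k x, (i k).baseChange Q ((Z.φ k).baseChange Q x) =
      (T.φ k).baseChange Q ((i (k + 1)).baseChange Q x) := fun k x => by
    rw [← LinearMap.comp_apply, ← LinearMap.baseChange_comp, ← LinearMap.comp_apply,
      ← LinearMap.baseChange_comp, show i k ∘ₗ Z.φ k = T.φ k ∘ₗ i (k + 1) from LinearMap.ext (hi k)]
  have hp' : ∀ k x, (p k).baseChange Q ((T.φ k).baseChange Q x) =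
      (Z.φ k).baseChange Q ((p (k + 1)).baseChange Q x) := fun k x => by
    rw [← LinearMap.comp_apply, ← LinearMap.baseChange_comp, ← LinearMap.comp_apply,
      ← LinearMap.baseChange_comp, show p k ∘ₗ T.φ k = Z.φ k ∘ₗ p (k + 1) from LinearMap.ext (hp k)]
  obtain ⟨t, ht⟩ := exists_finrank_eq_mul_of_shift_summand (φ := X.φ) (u := u) (ι := ι)
    hX.isUnit_or_isUnit_one_sub hu (fun k => (hn k).2) (fun k => (Z.φ k).baseChange Q)
    (fun k => (θ k).toLinearMap ∘ₗ (i k).baseChange Q)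
    (fun k => (p k).baseChange Q ∘ₗ (θ k).symm.toLinearMap)
    (fun k x => by
      change θ k _ = shiftMap X.φ u ι k (θ (k + 1) _)
      rw [← hθ, hi'])
    (fun k x => by
      obtain ⟨y, rfl⟩ := (θ (k + 1)).surjective x
      rw [← hθ]
      simp [hp'])
    (fun k => by
      refine LinearMap.ext fun x => ?_
      change (p k).baseChange Q ((θ k).symm (θ k ((i k).baseChange Q x))) = x
      rw [LinearEquiv.symm_apply_apply, ← LinearMap.comp_apply, ← LinearMap.baseChange_comp, hpi,
        LinearMap.baseChange_id]
      rfl)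
  refine ⟨t, fun k => ?_⟩
  have : Module.Free S (Z.obj k) := Module.free_of_flat_of_isLocalRing
  rw [← ht k, Module.finrank_baseChange]

end RankOfSummands

section TensorRestriction

variable {K Q₁ Q₂ S : Type u} [Field K] [CommRing Q₁] [CommRing Q₂] [CommRing S] [Algebra K S]
  [Algebra Q₁ S] [Algebra Q₂ S] {d : ℕ} [NeZero d] {f : Q₁} {g : Q₂}

/-- Along a retraction `S → Q₁` which kills the coefficients of the structure maps of `Y`, the
tensor product `X ⊗ Y` restricts to a direct sum of shifts of `X`. -/
theorem exists_restrict_left_equiv [Algebra S Q₁] [IsScalarTower Q₁ S Q₁] [IsLocalRing Q₂]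
    (hS : ∀ c ∈ IsLocalRing.maximalIdeal Q₂, algebraMap S Q₁ (algebraMap Q₂ S c) = 0)
    {ζ : K} (hζ : IsPrimitiveRoot ζ d) (X : MatFac Q₁ d f) {Y : MatFac Q₂ d g} (hY : Y.IsReduced)
    {m : ℕ} (hm : Y.HasRank m) :
    ∃ θ : ∀ k, Q₁ ⊗[S] (tensor ζ hζ (X.extendScalars (Q' := S)) (Y.extendScalars (Q' := S))).obj k
        ≃ₗ[Q₁] ShiftObj X.obj (Fin m) k,
      ∀ k x, θ k (((tensor ζ hζ X.extendScalars Y.extendScalars).φ k).baseChange Q₁ x) =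
        shiftMap X.φ 1 (Fin m) k (θ (k + 1) x) := by
  have hb : ∀ j, Nonempty (Module.Basis (Fin m) Q₂ (Y.obj j)) := fun j => by
    have := (hm j).1
    exact ⟨Module.finBasisOfFinrankEq Q₂ _ (hm j).2⟩
  let b := fun j => (hb j).some
  let θ : ∀ k, Q₁ ⊗[S] (tensor ζ hζ (X.extendScalars (Q' := S)) (Y.extendScalars (Q' := S))).obj k
      ≃ₗ[Q₁] ShiftObj X.obj (Fin m) k := fun k =>
    (TensorProduct.piRight S Q₁ Q₁ _).trans
      (LinearEquiv.piCongrRight fun p => retractTensorEquiv (b p.1.2))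
  refine ⟨θ, fun k => LinearMap.congr_fun (f := (θ k).toLinearMap ∘ₗ
    ((tensor ζ hζ (X.extendScalars (Q' := S)) (Y.extendScalars (Q' := S))).φ k).baseChange Q₁)
    (g := shiftMap X.φ 1 (Fin m) k ∘ₗ (θ (k + 1)).toLinearMap)
    (LinearMap.ext_tmul fun r t' => funext fun p => funext fun l => ?_)⟩
  · let t : ∀ p : {p : ZMod d × ZMod d // p.1 + p.2 = k + 1},
      (S ⊗[Q₁] X.obj p.1.1) ⊗[S] (S ⊗[Q₂] Y.obj p.1.2) := t'
    have h1 : p.1.1 + 1 + p.1.2 = k + 1 := by linear_combination p.2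
    have h2 : p.1.1 + (p.1.2 + 1) = k + 1 := by linear_combination p.2
    change retractTensorEquiv (b p.1.2) (r ⊗ₜ[S] (TensorProduct.map
        ((X.φ p.1.1).baseChange S) LinearMap.id (t ⟨(p.1.1 + 1, p.1.2), h1⟩) +
      (algebraMap K S ζ ^ p.1.1.val) • TensorProduct.map LinearMap.id
        ((Y.φ p.1.2).baseChange S) (t ⟨(p.1.1, p.1.2 + 1), h2⟩))) l =
      (1 : Q₁) • X.φ p.1.1 (retractTensorEquiv (b p.1.2) (r ⊗ₜ[S] t ⟨(p.1.1 + 1, p.1.2), h1⟩) l)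
    rw [one_smul, ← retractTensorEquiv_map_left, TensorProduct.tmul_add, TensorProduct.tmul_smul,
      ← algebraMap_smul Q₁, map_add, map_smul, ← LinearMap.baseChange_tmul,
      ← LinearMap.baseChange_tmul, retractTensorEquiv_map_right _ _ _ (hY _) hS, smul_zero,
      add_zero]

/-- Along a retraction `S → Q₂` which kills the coefficients of the structure maps of `X`, the
tensor product `X ⊗ Y` restricts to a direct sum of shifts of `Y`, up to the units by which
`ζ` twists the structure maps. -/
theorem exists_restrict_right_equiv [Algebra S Q₂] [IsScalarTower Q₂ S Q₂] [IsLocalRing Q₁]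
    (hS : ∀ c ∈ IsLocalRing.maximalIdeal Q₁, algebraMap S Q₂ (algebraMap Q₁ S c) = 0)
    {ζ : K} (hζ : IsPrimitiveRoot ζ d) {X : MatFac Q₁ d f} (hX : X.IsReduced) (Y : MatFac Q₂ d g)
    {n : ℕ} (hn : X.HasRank n) :
    ∃ θ : ∀ k, Q₂ ⊗[S] (tensor ζ hζ (X.extendScalars (Q' := S)) (Y.extendScalars (Q' := S))).obj k
        ≃ₗ[Q₂] ShiftObj Y.obj (Fin n) k,
      ∀ k x, θ k (((tensor ζ hζ X.extendScalars Y.extendScalars).φ k).baseChange Q₂ x) =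
        shiftMap Y.φ (fun j => algebraMap S Q₂ (algebraMap K S ζ ^ j.val)) (Fin n) k
          (θ (k + 1) x) := by
  have hb : ∀ j, Nonempty (Module.Basis (Fin n) Q₁ (X.obj j)) := fun j => by
    have := (hn j).1
    exact ⟨Module.finBasisOfFinrankEq Q₁ _ (hn j).2⟩
  let b := fun j => (hb j).some
  let swap : ∀ k : ZMod d, (∀ p : {p : ZMod d × ZMod d // p.1 + p.2 = k}, Fin n → Y.obj p.1.2)
      ≃ₗ[Q₂] ShiftObj Y.obj (Fin n) k := fun k =>
    { toFun := fun v p => v ⟨p.1.swap, (add_comm _ _).trans p.2⟩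
      map_add' := fun _ _ => rfl
      map_smul' := fun _ _ => rfl
      invFun := fun v p => v ⟨p.1.swap, (add_comm _ _).trans p.2⟩
      left_inv := fun _ => rfl
      right_inv := fun _ => rfl }
  let θ : ∀ k, Q₂ ⊗[S] (tensor ζ hζ (X.extendScalars (Q' := S)) (Y.extendScalars (Q' := S))).obj k
      ≃ₗ[Q₂] ShiftObj Y.obj (Fin n) k := fun k =>
    ((TensorProduct.piRight S Q₂ Q₂ _).trans
      (LinearEquiv.piCongrRight fun p => (LinearEquiv.baseChange S Q₂ _ _
        (TensorProduct.comm S (S ⊗[Q₁] X.obj p.1.1) (S ⊗[Q₂] Y.obj p.1.2))).trans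
          (retractTensorEquiv (b p.1.1)))).trans (swap k)
  refine ⟨θ, fun k => LinearMap.congr_fun (f := (θ k).toLinearMap ∘ₗ
    ((tensor ζ hζ (X.extendScalars (Q' := S)) (Y.extendScalars (Q' := S))).φ k).baseChange Q₂)
    (g := shiftMap Y.φ (fun j => algebraMap S Q₂ (algebraMap K S ζ ^ j.val)) (Fin n) k ∘ₗ
      (θ (k + 1)).toLinearMap)
    (LinearMap.ext_tmul fun r t' => funext fun p => funext fun l => ?_)⟩
  · let t : ∀ p : {p : ZMod d × ZMod d // p.1 + p.2 = k + 1},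
      (S ⊗[Q₁] X.obj p.1.1) ⊗[S] (S ⊗[Q₂] Y.obj p.1.2) := t'
    obtain ⟨⟨j, i⟩, hp⟩ := p
    have h1 : i + 1 + j = k + 1 := by linear_combination hp
    have h2 : i + (j + 1) = k + 1 := by linear_combination hp
    change retractTensorEquiv (b i) (r ⊗ₜ[S] TensorProduct.comm S _ _ (TensorProduct.map
        ((X.φ i).baseChange S) LinearMap.id (t ⟨(i + 1, j), h1⟩) +
      (algebraMap K S ζ ^ i.val) • TensorProduct.map LinearMap.id
        ((Y.φ j).baseChange S) (t ⟨(i, j + 1), h2⟩))) l =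
      algebraMap S Q₂ (algebraMap K S ζ ^ i.val) • Y.φ j (retractTensorEquiv (b i)
        (r ⊗ₜ[S] TensorProduct.comm S _ _ (t ⟨(i, j + 1), h2⟩)) l)
    rw [map_add, map_smul, ← TensorProduct.map_comm, ← TensorProduct.map_comm,
      ← retractTensorEquiv_map_left, TensorProduct.tmul_add, TensorProduct.tmul_smul,
      map_add, ← LinearMap.baseChange_tmul,
      ← LinearMap.baseChange_tmul, retractTensorEquiv_map_right _ _ _ (hX _) hS, zero_add,
      ← algebraMap_smul Q₂, map_smul]
    rfl

theorem finrank_tensor_extendScalars [StrongRankCondition Q₁] [StrongRankCondition Q₂]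
    [Nontrivial S] {ζ : K} (hζ : IsPrimitiveRoot ζ d)
    {X : MatFac Q₁ d f} {Y : MatFac Q₂ d g} {n m : ℕ} (hn : X.HasRank n) (hm : Y.HasRank m)
    (k : ZMod d) :
    Module.finrank S ((tensor ζ hζ (X.extendScalars (Q' := S)) (Y.extendScalars (Q' := S))).obj k) =
      d * (n * m) := by
  have hX : ∀ i, Module.Free Q₁ (X.obj i) := fun i => (hn i).1
  have hY : ∀ i, Module.Free Q₂ (Y.obj i) := fun i => (hm i).1
  have hcard : Fintype.card {p : ZMod d × ZMod d // p.1 + p.2 = k} = d := by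
    let e : {p : ZMod d × ZMod d // p.1 + p.2 = k} ≃ ZMod d :=
      { toFun := fun p => p.1.1
        invFun := fun i => ⟨(i, k - i), add_sub_cancel i k⟩
        left_inv := fun p => Subtype.ext (Prod.ext rfl (eq_sub_of_add_eq' p.2).symm)
        right_inv := fun _ => rfl }
    rw [Fintype.card_congr e, ZMod.card]
  change Module.finrank S (∀ p : {p : ZMod d × ZMod d // p.1 + p.2 = k},
    (S ⊗[Q₁] X.obj p.1.1) ⊗[S] (S ⊗[Q₂] Y.obj p.1.2)) = _
  rw [Module.finrank_pi_fintype]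
  simp only [Module.finrank_tensorProduct, Module.finrank_self, one_mul, (hn _).2, (hm _).2,
    Finset.sum_const, Finset.card_univ, hcard, smul_eq_mul]

end TensorRestriction

end MatFac

/-! ### The bound for power series rings -/

namespace MvPowerSeries

theorem maximalIdeal_eq_span_range_X {σ K : Type*} [Finite σ] [Field K] :
    IsLocalRing.maximalIdeal (MvPowerSeries σ K) = Ideal.span (Set.range X) := by
  refine le_antisymm (fun c hc => ?_) (Ideal.span_le.mpr ?_)
  -- A power series without constant term vanishes in the first quotient of the completion of the
  -- polynomial ring at the ideal of the variables, hence lies in the multiple of the completion by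
  -- that ideal.
  · have h0 : constantCoeff c = 0 := by
      by_contra h0
      exact hc (isUnit_iff_constantCoeff.mpr (isUnit_iff_ne_zero.mpr h0))
    let e := (toAdicCompletionAlgEquiv σ K).toLinearEquiv
    have h1 : e c ∈ (MvPolynomial.idealOfVars σ K ^ 1 •
        (⊤ : Submodule (MvPolynomial σ K)
          (AdicCompletion (MvPolynomial.idealOfVars σ K) (MvPolynomial σ K)))) := by
      rw [AdicCompletion.pow_smul_top_eq_ker_eval (MvPolynomial.idealOfVars_fg σ K)]
      change (Ideal.Quotient.mk _ (truncTotal 1 c)) = 0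
      rw [Ideal.Quotient.eq_zero_iff_mem, smul_eq_mul, Ideal.mul_top,
        MvPolynomial.mem_pow_idealOfVars_iff']
      intro x hx
      rw [coeff_truncTotal _ hx]
      obtain rfl : x = 0 := (Finsupp.degree_eq_zero_iff x).mp (Nat.lt_one_iff.mp hx)
      simpa using h0
    rw [pow_one] at h1
    have h2 := Submodule.mem_map_of_mem (f := e.symm.toLinearMap) h1
    rw [Submodule.map_smul''] at h2
    have h3 : e.symm.toLinearMap (e c) = c := e.symm_apply_apply c
    rw [h3] at h2
    refine Submodule.smul_induction_on h2 (fun r hr n _ => ?_) (fun _ _ => add_mem)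
    rw [Algebra.smul_def]
    have h4 : MvPolynomial.idealOfVars σ K ≤ (Ideal.span (Set.range X)).comap
        (algebraMap (MvPolynomial σ K) (MvPowerSeries σ K)) := ?_
    · exact Ideal.mul_mem_right _ _ (h4 hr)
    refine Ideal.span_le.mpr ?_
    rintro _ ⟨i, rfl⟩
    exact Ideal.subset_span ⟨i, by rw [algebraMap_apply']; simp⟩
  · rintro _ ⟨i, rfl⟩
    intro h
    simpa using isUnit_iff_constantCoeff.mp h

instance isAdicComplete_maximalIdeal {σ K : Type*} [Finite σ] [Field K] :
    IsAdicComplete (IsLocalRing.maximalIdeal (MvPowerSeries σ K)) (MvPowerSeries σ K) := by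
  rw [maximalIdeal_eq_span_range_X]
  infer_instance

/-- Setting all variables outside `σ` to zero kills every power series without constant term in
variables disjoint from `σ`. -/
theorem killCompl_rename_eq_zero {σ τ υ K : Type*} [Field K] (e : σ ↪ υ) (e' : τ ↪ υ)
    (h : ∀ i j, e i ≠ e' j) {c : MvPowerSeries τ K}
    (hc : c ∈ IsLocalRing.maximalIdeal (MvPowerSeries τ K)) :
    killCompl e (rename e' c) = 0 := by
  have h0 : constantCoeff c = 0 := by
    by_contra h0
    exact hc (isUnit_iff_constantCoeff.mpr (isUnit_iff_ne_zero.mpr h0))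
  ext x
  rw [coeff_killCompl, map_zero]
  by_cases hx : x = 0
  · subst hx
    have := coeff_embDomain_rename e' c 0
    simp only [Finsupp.embDomain_zero] at this ⊢
    rw [this]
    simpa using h0
  · refine coeff_rename_eq_zero _ _ ?_
    rintro ⟨y, hy⟩
    obtain ⟨i, hi⟩ := Finsupp.ne_iff.mp hx
    have h1 := congrArg (fun z => z (e i)) hy
    simp only [Finsupp.embDomain_apply_self] at h1
    rw [Finsupp.mapDomain_of_notMem_range] at h1
    · exact hi h1.symm
    · rintro ⟨j, hj⟩
      exact h i j hj.symm

end MvPowerSeries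

namespace MatFac

variable {Q₁ Q₂ S : Type u} {K : Type u} [Field K]

/-- If the ranks of all direct summands of `T` are multiples of `n` and of `m`, and `T` has rank
`d n m`, then each nonzero summand has rank at least `lcm n m`, so there are at most
`d n m / lcm n m = d gcd n m` of them. -/
theorem le_mul_gcd_of_decomposesInto [CommRing S] [IsLocalRing S] {d : ℕ} [NeZero d] {h : S}
    {T : MatFac S d h} {n m : ℕ} (hnm : 0 < n * m)
    (hT : ∀ k, Module.finrank S (T.obj k) = d * (n * m))
    (hleft : ∀ (Z : MatFac S d h) (i : ∀ k, Z.obj k →ₗ[S] T.obj k)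
      (p : ∀ k, T.obj k →ₗ[S] Z.obj k), (∀ k x, i k (Z.φ k x) = T.φ k (i (k + 1) x)) →
      (∀ k x, p k (T.φ k x) = Z.φ k (p (k + 1) x)) → (∀ k, p k ∘ₗ i k = LinearMap.id) →
      ∃ t : ℕ, ∀ k, Module.finrank S (Z.obj k) = t * n)
    (hright : ∀ (Z : MatFac S d h) (i : ∀ k, Z.obj k →ₗ[S] T.obj k)
      (p : ∀ k, T.obj k →ₗ[S] Z.obj k), (∀ k x, i k (Z.φ k x) = T.φ k (i (k + 1) x)) →
      (∀ k x, p k (T.φ k x) = Z.φ k (p (k + 1) x)) → (∀ k, p k ∘ₗ i k = LinearMap.id) →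
      ∃ t : ℕ, ∀ k, Module.finrank S (Z.obj k) = t * m)
    {N : ℕ} (hN : T.DecomposesInto N) : N ≤ d * Nat.gcd n m := by
  obtain ⟨Z, hZ, ⟨E⟩⟩ := hN
  have hfree : ∀ j k, Module.Free S ((Z j).obj k) := fun j k => Module.free_of_flat_of_isLocalRing
  have hdvd : ∀ j, Nat.lcm n m ≤ Module.finrank S ((Z j).obj 0) := by
    intro j
    let s : ∀ k, (Z j).obj k →ₗ[S] (directSum Z).obj k := fun k =>
      LinearMap.single S (fun j => (Z j).obj k) j
    have hs : ∀ k x, s k ((Z j).φ k x) = (directSum Z).φ k (s (k + 1) x) := fun k x => by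
      refine funext fun j' => ?_
      change (Pi.single j ((Z j).φ k x) : ∀ j, (Z j).obj k) j' =
        (Z j').φ k ((Pi.single j x : ∀ j, (Z j).obj (k + 1)) j')
      by_cases hj : j' = j
      · subst hj; simp
      · simp [Pi.single_eq_of_ne hj]
    let i : ∀ k, (Z j).obj k →ₗ[S] T.obj k := fun k => (E.e k).symm.toLinearMap ∘ₗ s k
    let p : ∀ k, T.obj k →ₗ[S] (Z j).obj k := fun k =>
      LinearMap.proj (φ := fun j => (Z j).obj k) j ∘ₗ (E.e k).toLinearMap
    have hi : ∀ k x, i k ((Z j).φ k x) = T.φ k (i (k + 1) x) := fun k x => by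
      refine (E.e k).injective ?_
      rw [E.comm]
      change E.e k ((E.e k).symm (s k ((Z j).φ k x))) = (directSum Z).φ k
        (E.e (k + 1) ((E.e (k + 1)).symm (s (k + 1) x)))
      rw [LinearEquiv.apply_symm_apply, LinearEquiv.apply_symm_apply, hs]
    have hp : ∀ k x, p k (T.φ k x) = (Z j).φ k (p (k + 1) x) := fun k x =>
      congrFun (E.comm k x) j
    have hpi : ∀ k, p k ∘ₗ i k = LinearMap.id := fun k => LinearMap.ext fun x => by
      change E.e k ((E.e k).symm (s k x)) j = x
      rw [LinearEquiv.apply_symm_apply]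
      exact Pi.single_eq_same (M := fun j => (Z j).obj k) j x
    obtain ⟨t, ht⟩ := hleft (Z j) i p hi hp hpi
    obtain ⟨t', ht'⟩ := hright (Z j) i p hi hp hpi
    refine Nat.le_of_dvd (Nat.pos_of_ne_zero fun h0 => (hZ j).1 fun k => ?_)
      (Nat.lcm_dvd (Dvd.intro_left t (ht 0).symm) (Dvd.intro_left t' (ht' 0).symm))
    have hn : 0 < n := Nat.pos_of_mul_pos_right hnm
    have ht0 : t = 0 := by
      have := ht 0
      rw [h0] at this
      exact (Nat.mul_eq_zero.mp this.symm).resolve_right hn.ne'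
    exact (Module.finrank_eq_zero_iff_of_free S _).mp (by rw [ht k, ht0, zero_mul])
  have hsum : d * (n * m) = ∑ j, Module.finrank S ((Z j).obj 0) := by
    rw [← hT 0, (E.e 0).finrank_eq]
    exact Module.finrank_pi_fintype S (M := fun j => (Z j).obj 0)
  have hle : N * Nat.lcm n m ≤ d * (n * m) := by
    rw [hsum]
    simpa using Finset.card_nsmul_le_sum Finset.univ (fun j => Module.finrank S ((Z j).obj 0))
      (Nat.lcm n m) fun j _ => hdvd j
  rw [← Nat.gcd_mul_lcm n m] at hnm
  rw [← Nat.gcd_mul_lcm n m, ← mul_assoc] at hle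
  exact Nat.le_of_mul_le_mul_right hle (Nat.pos_of_mul_pos_left hnm)

theorem Indecomposable.pos_of_hasRank {Q : Type u} [CommRing Q] [Nontrivial Q] {d : ℕ} [NeZero d]
    {f : Q} {X : MatFac Q d f} (hX : X.Indecomposable) {n : ℕ} (hn : X.HasRank n) : 0 < n := by
  refine Nat.pos_of_ne_zero fun h0 => hX.1 fun k => ?_
  have := (hn k).1
  exact (Module.finrank_eq_zero_iff_of_free Q _).mp ((hn k).2.trans h0)

/-- The bound over an arbitrary local ring `S` that retracts to two complete noetherian local rings
`Q₁` and `Q₂`, each retraction killing the maximal ideal of the other ring. -/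
theorem le_mul_gcd_of_tensor_decomposesInto [CommRing Q₁] [CommRing Q₂] [CommRing S]
    [IsLocalRing Q₁] [IsLocalRing Q₂] [IsLocalRing S] [IsNoetherianRing Q₁] [IsNoetherianRing Q₂]
    [IsAdicComplete (IsLocalRing.maximalIdeal Q₁) Q₁]
    [IsAdicComplete (IsLocalRing.maximalIdeal Q₂) Q₂] [Algebra K S] [Algebra Q₁ S] [Algebra Q₂ S]
    [Algebra S Q₁] [Algebra S Q₂] [IsScalarTower Q₁ S Q₁] [IsScalarTower Q₂ S Q₂]
    (h₁ : ∀ c ∈ IsLocalRing.maximalIdeal Q₂, algebraMap S Q₁ (algebraMap Q₂ S c) = 0)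
    (h₂ : ∀ c ∈ IsLocalRing.maximalIdeal Q₁, algebraMap S Q₂ (algebraMap Q₁ S c) = 0)
    {d : ℕ} [NeZero d] {ζ : K} (hζ : IsPrimitiveRoot ζ d) {f : Q₁} {g : Q₂}
    {X : MatFac Q₁ d f} (hX : X.Indecomposable) (hXr : X.IsReduced)
    {Y : MatFac Q₂ d g} (hY : Y.Indecomposable) (hYr : Y.IsReduced)
    {n m : ℕ} (hn : X.HasRank n) (hm : Y.HasRank m) {N : ℕ}
    (hN : (tensor ζ hζ (X.extendScalars (Q' := S)) (Y.extendScalars (Q' := S))).DecomposesInto N) :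
    N ≤ d * Nat.gcd n m := by
  obtain ⟨θ, hθ⟩ := exists_restrict_left_equiv (S := S) h₁ hζ X hYr hm
  obtain ⟨θ', hθ'⟩ := exists_restrict_right_equiv (S := S) h₂ hζ hXr Y hn
  refine le_mul_gcd_of_decomposesInto
    (Nat.mul_pos (hX.pos_of_hasRank hn) (hY.pos_of_hasRank hm))
    (finrank_tensor_extendScalars hζ hn hm) ?_ ?_ hN
  · intro Z i p hi hp hpi
    exact exists_finrank_eq_mul_of_baseChange_equiv hX hn (fun _ => isUnit_one) θ hθ
      i p hi hp hpi
  · intro Z i p hi hp hpi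
    refine exists_finrank_eq_mul_of_baseChange_equiv hY hm (fun j => ?_) θ' hθ'
      i p hi hp hpi
    exact (((hζ.isUnit (NeZero.ne d)).map _).pow _).map _

end MatFac

theorem theorem5p2 {K : Type u} [Field K] (d : ℕ) [NeZero d] (hd : 2 ≤ d)
    (ζ : K) (hζ : IsPrimitiveRoot ζ d) (a b : ℕ)
    (f : MvPowerSeries (Fin a) K) (hf : f ≠ 0) (hf' : ¬ IsUnit f)
    (g : MvPowerSeries (Fin b) K) (hg : g ≠ 0) (hg' : ¬ IsUnit g)
    (X : MatFac (MvPowerSeries (Fin a) K) d f) (hX : X.Indecomposable) (hXr : X.IsReduced)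
    (Y : MatFac (MvPowerSeries (Fin b) K) d g) (hY : Y.Indecomposable) (hYr : Y.IsReduced)
    (n m : ℕ) (hn : X.HasRank n) (hm : Y.HasRank m) :
    (∃ N : ℕ, (MatFac.disjointTensor ζ hζ X Y).DecomposesInto N) ∧
      ∀ N : ℕ, (MatFac.disjointTensor ζ hζ X Y).DecomposesInto N → N ≤ d * Nat.gcd n m := by
  refine ⟨MatFac.exists_decomposesInto _, fun N => ?_⟩
  let _ : Algebra (MvPowerSeries (Fin a) K) (MvPowerSeries (Fin a ⊕ Fin b) K) :=
    (MatFac.inclLeft K a b).toAlgebra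
  let _ : Algebra (MvPowerSeries (Fin b) K) (MvPowerSeries (Fin a ⊕ Fin b) K) :=
    (MatFac.inclRight K a b).toAlgebra
  let _ : Algebra (MvPowerSeries (Fin a ⊕ Fin b) K) (MvPowerSeries (Fin a) K) :=
    (MvPowerSeries.killCompl (R := K) (.inl : Fin a ↪ Fin a ⊕ Fin b)).toRingHom.toAlgebra
  let _ : Algebra (MvPowerSeries (Fin a ⊕ Fin b) K) (MvPowerSeries (Fin b) K) :=
    (MvPowerSeries.killCompl (R := K) (.inr : Fin b ↪ Fin a ⊕ Fin b)).toRingHom.toAlgebra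
  have t₁ : IsScalarTower (MvPowerSeries (Fin a) K) (MvPowerSeries (Fin a ⊕ Fin b) K)
      (MvPowerSeries (Fin a) K) := .of_algebraMap_eq fun x =>
    (MvPowerSeries.killCompl_rename_app x).symm
  have t₂ : IsScalarTower (MvPowerSeries (Fin b) K) (MvPowerSeries (Fin a ⊕ Fin b) K)
      (MvPowerSeries (Fin b) K) := .of_algebraMap_eq fun x =>
    (MvPowerSeries.killCompl_rename_app x).symm
  have h₁ : ∀ c ∈ IsLocalRing.maximalIdeal (MvPowerSeries (Fin b) K),
      algebraMap (MvPowerSeries (Fin a ⊕ Fin b) K) (MvPowerSeries (Fin a) K)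
        (algebraMap (MvPowerSeries (Fin b) K) (MvPowerSeries (Fin a ⊕ Fin b) K) c) = 0 :=
    fun c hc => MvPowerSeries.killCompl_rename_eq_zero _ _ (fun _ _ => Sum.inl_ne_inr) hc
  have h₂ : ∀ c ∈ IsLocalRing.maximalIdeal (MvPowerSeries (Fin a) K),
      algebraMap (MvPowerSeries (Fin a ⊕ Fin b) K) (MvPowerSeries (Fin b) K)
        (algebraMap (MvPowerSeries (Fin a) K) (MvPowerSeries (Fin a ⊕ Fin b) K) c) = 0 :=
    fun c hc => MvPowerSeries.killCompl_rename_eq_zero _ _ (fun _ _ => Sum.inr_ne_inl) hc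
  intro hN
  exact MatFac.le_mul_gcd_of_tensor_decomposesInto h₁ h₂ hζ hX hXr hY hYr hn hm hN
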